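/- **Setting.** Let $\mathcal T_*$ be the category of pointed connected compactly generated spaces and $\mathrm{ho}\,\mathcal T_*$ its homotopy category (pointed homotopy classes of pointed maps). A *lattice* $\Gamma$ is a finite directed category, regarded as non-unital (so $\Gamma(v,v)=\emptyset$ for all $v$), with objects $v_{\mathrm{init}},v_{\mathrm{fin}}$ such that every $w\ne v_{\mathrm{init}}$ receives an arrow from $v_{\mathrm{init}}$, every $w\neq v_{\mathrm{fin}}$ has an arrow to $v_{\mathrm{fin}}$, there is exactly one arrow $\phi_{\max}:v_{\mathrm{init}}\to v_{\mathrm{fin}}$, and there is an object different from $v_{\mathrm{init}}$ and $v_{\mathrm{fin}}$. *Initial data* is a functor $\mathcal A:\Gamma\to\mathrm{ho}\,\mathcal T_*$. The topological category $W\Gamma$ has the objects of $\Gamma$ and morphism spaces $W\Gamma(u,v)=\bigsqcup_{n\ge0}\Gamma_{n+1}(u,v)\times I^n/\!\sim$, where $\Gamma_{n+1}(u,v)$ is the discrete set of chains of $n+1$ composable arrows from $u$ to $v$, the $n$ coordinates are attached to the internal nodes of the chain, and $\sim$ composes the two arrows at any internal node with coordinate $0$; composition is concatenation with coordinate $1$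 at the new node. A chain $\Phi$ of $n+1$ arrows defines an $n$-cube $C[\Phi]$; its faces of dimension $\le k$ consist of the points with at most $k$ coordinates different from $0,1$. The subcategory $bW\Gamma$ has $bW\Gamma(u,v)=W\Gamma(u,v)$ for $(u,v)\ne(v_{\mathrm{init}},v_{\mathrm{fin}})$, while $bW\Gamma(v_{\mathrm{init}},v_{\mathrm{fin}})$ consists of the decomposable morphisms; $\mathrm{sk}_k\,bW\Gamma$ is the subcategory generated by its faces of dimension $\le k$. An *$n$-realization* of $\mathcal A$ is a continuous functor $\bar{\mathcal A}_n:\mathrm{sk}_n\,bW\Gamma\to\mathcal T_*$ with $\bar{\mathcal A}_n(v)=\mathcal A(v)$ for every object $v$ and $[\bar{\mathcal A}_n(f)]=\mathcal A(f)$ for every arrow $f\neq\phi_{\max}$ of $\Gamma$. For $n\ge 1$, an *indecomposable $n$-cube* of $bW\Gamma$ is given by a chain $\Psi$ of $n+1$ arrows of $\Gamma$ that does not run from $v_{\mathrm{init}}$ to $v_{\mathrm{fin}}$; $\Gamma_\Psi\subset\Gamma$ denotes the sublattice generated by the arrows of $\Psi$, and $W\Gamma_\Psi\subset W\Gamma$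 its $W$-construction. A *common $k$-face* of two distinct indecomposable $(k+1)$-cubes $\Psi,\Psi'$ is an indecomposable $k$-cube $\chi$ all of whose arrows lie in both $\Gamma_\Psi$ and $\Gamma_{\Psi'}$. For a $k$-cube $C$ and pointed spaces $X,Y$, two maps $F_1,F_2:X\rtimes C\to Y$ agreeing with $f$ on $X\rtimes\partial C$ define a map $D_{F_1,F_2}:X\rtimes(C\cup_{\partial C}C)\to Y$, where $C\cup_{\partial C}C\cong\Sigma\partial C$ and $X\rtimes K=(X\times K)/(\{*\}\times K)$. Its homotopy class $\delta_f(F_1,F_2)$ relative to $X\rtimes\partial C$ is the *difference obstruction*. It is *null* if $D_{F_1,F_2}$, as a map from $\Sigma\partial C$ to the space of pointed maps $X\to Y$, is homotopic to a constant map. Given $k\geq1$ and a $(k-1)$-realization $\bar{\mathcal A}_{k-1}$, suppose that for each indecomposable $(k+1)$-cube $\Psi$ a continuous functor $F_\Psi:W\Gamma_\Psi\to\mathcal T_*$ is chosen that agrees with $\bar{\mathcal A}_{k-1}$ on $\mathrm{sk}_{k-1}W\Gamma_\Psi$. The *obstruction sequence* of $\bar{\mathcal A}_{k-1}$ determined by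 $(F_\Psi)_\Psi$ is the family of the difference obstructions $\delta_{\bar{\mathcal A}_{k-1}}(F_\Psi|_{C[\chi]},F_{\Psi'}|_{C[\chi]})$, indexed by all pairs $\Psi\ne\Psi'$ of indecomposable $(k+1)$-cubes and all their common $k$-faces $\chi$; here $X=\mathcal A(x)$ and $Y=\mathcal A(y)$ if $\chi$ runs from $x$ to $y$. It *vanishes* if each of its components is null. **Theorem.** Let $\mathcal A:\Gamma\to\mathrm{ho}\,\mathcal T_*$ be initial data, let $k\ge1$, and let $\bar{\mathcal A}_{k-1}:\mathrm{sk}_{k-1}\,bW\Gamma\to\mathcal T_*$ be a $(k-1)$-realization of $\mathcal A$ that can be extended to a $k$-realization. Then $\bar{\mathcal A}_{k-1}$ can be extended to a $(k+1)$-realization if and only if it has some vanishing obstruction sequence. -/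

import Mathlib

universe u v w

noncomputable section

open Topology
open scoped unitInterval

namespace HHO

/-! ## Pointed spaces and their homotopy category -/

/-- An object of `T_*`: a pointed connected compactly generated space. -/
structure PointedSpace where
  carrier : Type w
  [top : TopologicalSpace carrier]
  [compactlyGenerated : CompactlyGeneratedSpace carrier]
  [connected : ConnectedSpace carrier]
  pt : carrier

instance : CoeSort PointedSpace.{w} (Type w) := ⟨PointedSpace.carrier⟩

instance (X : PointedSpace.{w}) : TopologicalSpace X := X.top

/-- Morphisms of `T_*`: continuous maps preserving the base point. -/
abbrev PMap (X Y : PointedSpace.{w}) := {f : C(X, Y) // f X.pt = Y.pt}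

/-- Composition in diagrammatic order. -/
def PMap.comp {X Y Z : PointedSpace.{w}} (f : PMap X Y) (g : PMap Y Z) : PMap X Z :=
  ⟨g.1.comp f.1, by simp [f.2, g.2]⟩

/-- Two pointed maps are identified if they are homotopic relative to the base point. -/
instance PMap.setoid (X Y : PointedSpace.{w}) : Setoid (PMap X Y) where
  r f g := ContinuousMap.HomotopicRel f.1 g.1 {X.pt}
  iseqv := ⟨fun f => .refl f.1, fun h => h.symm, fun h h' => h.trans h'⟩

/-- Morphisms of `ho T_*`: pointed homotopy classes of pointed maps. -/
def HoMap (X Y : PointedSpace.{w}) := Quotient (PMap.setoid X Y)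

theorem PMap.comp_homotopic {X Y Z : PointedSpace.{w}} {f f' : PMap X Y} {g g' : PMap Y Z}
    (hf : f ≈ f') (hg : g ≈ g') : f.comp g ≈ f'.comp g' := by
  obtain ⟨H⟩ := hf
  obtain ⟨K⟩ := hg
  refine ⟨⟨K.toHomotopy.comp H.toHomotopy, ?_⟩⟩
  rintro t x rfl
  have h1 : H (t, X.pt) = Y.pt := (H.eq_fst t rfl).trans f.2
  have h2 : K (t, Y.pt) = Z.pt := (K.eq_fst t rfl).trans g.2
  change K (t, H (t, X.pt)) = g.1 (f.1 X.pt)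
  rw [h1, h2, f.2, g.2]

/-- Composition in `ho T_*`, in diagrammatic order. -/
def HoMap.comp {X Y Z : PointedSpace.{w}} : HoMap X Y → HoMap Y Z → HoMap X Z :=
  Quotient.map₂ PMap.comp fun _ _ hf _ _ hg => PMap.comp_homotopic hf hg

/-! ## Lattices and initial data -/

/-- A lattice: a finite directed category with a weak initial object, a weak terminal object, a
unique (maximal) arrow between the two, and at least one further object.  Since a directed category
has no loops, identities are omitted, so that `Hom x x` is empty. -/
structure LatticeCat where
  V : Type u
  [finV : Finite V]
  Hom : V → V → Type v
  [finHom : ∀ x y, Finite (Hom x y)]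
  /-- Composition, in diagrammatic order. -/
  comp : ∀ {x y z}, Hom x y → Hom y z → Hom x z
  assoc : ∀ {x y z t} (f : Hom x y) (g : Hom y z) (h : Hom z t),
    comp (comp f g) h = comp f (comp g h)
  directed : ∀ x, IsEmpty (Hom x x)
  vinit : V
  vfin : V
  weak_initial : ∀ x, x ≠ vinit → Nonempty (Hom vinit x)
  weak_terminal : ∀ x, x ≠ vfin → Nonempty (Hom x vfin)
  /-- The unique arrow from `vinit` to `vfin`. -/
  phiMax : Hom vinit vfin
  eq_phiMax : ∀ f : Hom vinit vfin, f = phiMax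
  nontrivial : ∃ x, x ≠ vinit ∧ x ≠ vfin

/-- Initial data: a functor from a lattice to `ho T_*`. -/
structure InitialData (Γ : LatticeCat.{u, v}) where
  obj : Γ.V → PointedSpace.{w}
  map : ∀ {x y}, Γ.Hom x y → HoMap (obj x) (obj y)
  map_comp : ∀ {x y z} (f : Γ.Hom x y) (g : Γ.Hom y z),
    map (Γ.comp f g) = (map f).comp (map g)

variable {Γ : LatticeCat.{u, v}}

/-! ## The W-construction -/

/-- Nonempty chains of composable arrows, listed from the source to the target. -/
inductive Chain (Γ : LatticeCat.{u, v}) : Γ.V → Γ.V → Type (max u v)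
  | single {x y : Γ.V} (f : Γ.Hom x y) : Chain Γ x y
  | cons {x y z : Γ.V} (f : Γ.Hom x y) (c : Chain Γ y z) : Chain Γ x z

/-- The dimension of the cube of a chain, i.e. the number of internal nodes: a chain of `n + 1`
arrows has dimension `n`. -/
def Chain.dim : ∀ {x y : Γ.V}, Chain Γ x y → ℕ
  | _, _, .single _ => 0
  | _, _, .cons _ c => c.dim + 1

/-- The arrows of a chain, together with their end points. -/
def Chain.arrows : ∀ {x y : Γ.V}, Chain Γ x y → List (Σ a b : Γ.V, Γ.Hom a b)
  | _, _, .single f => [⟨_, _, f⟩]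
  | _, _, .cons f c => ⟨_, _, f⟩ :: c.arrows

/-- The points of the disjoint union of the spaces `Γ_{n+1}(x,y) × I^n`: chains
with a parameter `t ∈ I` attached to each internal node. -/
inductive WPt (Γ : LatticeCat.{u, v}) : Γ.V → Γ.V → Type (max u v)
  | single {x y : Γ.V} (f : Γ.Hom x y) : WPt Γ x y
  | cons {x y z : Γ.V} (f : Γ.Hom x y) (t : I) (p : WPt Γ y z) : WPt Γ x z

/-- The inclusion of the summand `{c} × I^n`. -/
def WPt.mk : ∀ {x y : Γ.V} (c : Chain Γ x y), (Fin c.dim → I) → WPt Γ x y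
  | _, _, .single f, _ => .single f
  | _, _, .cons f c, t => .cons f (t (0 : Fin (c.dim + 1))) (WPt.mk c (Fin.tail (n := c.dim) t))

/-- The disjoint union topology. -/
instance (x y : Γ.V) : TopologicalSpace (WPt Γ x y) :=
  ⨆ c : Chain Γ x y, TopologicalSpace.coinduced (WPt.mk c) inferInstance

/-- The underlying arrows of a chain with parameters. -/
def WPt.arrows : ∀ {x y : Γ.V}, WPt Γ x y → List (Σ a b : Γ.V, Γ.Hom a b)
  | _, _, .single f => [⟨_, _, f⟩]
  | _, _, .cons f _ p => ⟨_, _, f⟩ :: p.arrows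

/-- The relation that composes the two arrows at an internal node with parameter `0`. -/
inductive WPt.Rel : ∀ {x y : Γ.V}, WPt Γ x y → WPt Γ x y → Prop
  | last {x y z : Γ.V} (f : Γ.Hom x y) (g : Γ.Hom y z) :
      WPt.Rel (.cons f 0 (.single g)) (.single (Γ.comp f g))
  | inner {x y z s : Γ.V} (f : Γ.Hom x y) (g : Γ.Hom y z) (t : I) (p : WPt Γ z s) :
      WPt.Rel (.cons f 0 (.cons g t p)) (.cons (Γ.comp f g) t p)
  | tail {x y z : Γ.V} (f : Γ.Hom x y) (t : I) {p q : WPt Γ y z} :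
      WPt.Rel p q → WPt.Rel (.cons f t p) (.cons f t q)

/-- The space of morphisms `WΓ(x,y)`, with the quotient topology. -/
def W (Γ : LatticeCat.{u, v}) (x y : Γ.V) := Quot (WPt.Rel (Γ := Γ) (x := x) (y := y))

instance (x y : Γ.V) : TopologicalSpace (W Γ x y) :=
  inferInstanceAs (TopologicalSpace (Quot (WPt.Rel (Γ := Γ) (x := x) (y := y))))

/-- The characteristic map of the cube `C[c]`. -/
def W.cube {x y : Γ.V} (c : Chain Γ x y) (t : Fin c.dim → I) : W Γ x y :=
  Quot.mk _ (WPt.mk c t)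

/-- The image in `WΓ` of an arrow of `Γ`. -/
def W.arrow {x y : Γ.V} (f : Γ.Hom x y) : W Γ x y := Quot.mk _ (.single f)

/-- Concatenation, with parameter `1` at the new internal node. -/
def WPt.append : ∀ {x y z : Γ.V}, WPt Γ x y → WPt Γ y z → WPt Γ x z
  | _, _, _, .single f, q => .cons f 1 q
  | _, _, _, .cons f t p, q => .cons f t (p.append q)

theorem WPt.Rel.append_left {x y z : Γ.V} {p p' : WPt Γ x y} (h : WPt.Rel p p')
    (q : WPt Γ y z) : WPt.Rel (p.append q) (p'.append q) := by
  induction h with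
  | last f g => exact .inner f g 1 q
  | inner f g t p => exact .inner f g t (p.append q)
  | tail f t _ ih => exact .tail f t (ih q)

theorem WPt.Rel.append_right {x y z : Γ.V} (p : WPt Γ x y) {q q' : WPt Γ y z}
    (h : WPt.Rel q q') : WPt.Rel (p.append q) (p.append q') := by
  induction p with
  | single f => exact .tail f 1 h
  | cons f t p ih => exact .tail f t (ih h)

/-- Composition in `WΓ`, in diagrammatic order. -/
def W.comp {x y z : Γ.V} : W Γ x y → W Γ y z → W Γ x z :=
  Quot.map₂ WPt.append (fun p _ _ h => WPt.Rel.append_right p h)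
    (fun _ _ q h => WPt.Rel.append_left h q)

/-- A (non-unital) subcategory of `WΓ` on all objects; its morphism spaces carry the subspace
topology. -/
structure Subcat (Γ : LatticeCat.{u, v}) where
  mor : ∀ x y : Γ.V, Set (W Γ x y)
  comp_mem : ∀ {x y z : Γ.V} {a : W Γ x y} {b : W Γ y z},
    a ∈ mor x y → b ∈ mor y z → a.comp b ∈ mor x z

/-- The morphisms of `bWΓ`: all morphisms of `WΓ(x,y)` if `(x,y) ≠ (vinit,vfin)`, and the
decomposable ones otherwise. -/
def IsBasic {x y : Γ.V} (a : W Γ x y) : Prop :=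
  ¬ (x = Γ.vinit ∧ y = Γ.vfin) ∨
    ∃ z : Γ.V, z ≠ Γ.vinit ∧ z ≠ Γ.vfin ∧ ∃ (b : W Γ x z) (c : W Γ z y), a = b.comp c

/-- The point lies on a face of dimension at most `k` of `C[c]` for some chain `c`: at most `k`
of its coordinates are different from `0` and `1`. -/
def InFace (k : ℕ) {x y : Γ.V} (a : W Γ x y) : Prop :=
  ∃ (c : Chain Γ x y) (t : Fin c.dim → I),
    a = W.cube c t ∧ {i | t i ≠ 0 ∧ t i ≠ 1}.ncard ≤ k

/-- The morphisms generated by the points of `bWΓ` on faces of dimension at most `k`. -/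
inductive InSkeleton (k : ℕ) : ∀ {x y : Γ.V}, W Γ x y → Prop
  | face {x y : Γ.V} (a : W Γ x y) : IsBasic a → InFace k a → InSkeleton k a
  | comp {x y z : Γ.V} (a : W Γ x y) (b : W Γ y z) :
      InSkeleton k a → InSkeleton k b → InSkeleton k (a.comp b)

/-- The `k`-skeleton of `bWΓ`. -/
def skeleton (Γ : LatticeCat.{u, v}) (k : ℕ) : Subcat Γ where
  mor _ _ := {a | InSkeleton k a}
  comp_mem := .comp _ _

theorem arrow_mem_skeleton (k : ℕ) {x y : Γ.V} (h : ¬ (x = Γ.vinit ∧ y = Γ.vfin))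
    (f : Γ.Hom x y) : W.arrow f ∈ (skeleton Γ k).mor x y := by
  refine .face _ (.inl h) ⟨.single f, Fin.elim0, rfl, ?_⟩
  have : {i : Fin (Chain.single f).dim | (Fin.elim0 i : I) ≠ 0 ∧ (Fin.elim0 i : I) ≠ 1} = ∅ :=
    Set.eq_empty_of_forall_notMem fun i => i.elim0
  rw [this, Set.ncard_empty]
  exact k.zero_le

/-! ## Continuous functors and realizations -/

/-- A continuous functor to `T_*` from a subcategory of `WΓ`, with prescribed values `X` on objects.
Continuity of `U(x,y) → T_*(X x, X y)` is expressed by continuity of the adjoint map. -/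
structure CFunctor (X : Γ.V → PointedSpace.{w}) (U : Subcat Γ) where
  map : ∀ {x y : Γ.V}, U.mor x y → X x → X y
  continuous_map : ∀ x y : Γ.V, Continuous fun p : X x × U.mor x y => map p.2 p.1
  map_pt : ∀ {x y : Γ.V} (a : U.mor x y), map a (X x).pt = (X y).pt
  map_comp : ∀ {x y z : Γ.V} (a : U.mor x y) (b : U.mor y z) (s : X x),
    map ⟨a.1.comp b.1, U.comp_mem a.2 b.2⟩ s = map b (map a s)

/-- The value of a functor on a morphism, as a morphism of `T_*`. -/
def CFunctor.pmap {X : Γ.V → PointedSpace.{w}} {U : Subcat Γ} (F : CFunctor X U) {x y : Γ.V}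
    (a : U.mor x y) : PMap (X x) (X y) :=
  ⟨⟨F.map a, (F.continuous_map x y).comp (Continuous.prodMk_left a)⟩, F.map_pt a⟩

/-- Two functors with the same values on objects agree on all common morphisms. -/
def CFunctor.Agree {X : Γ.V → PointedSpace.{w}} {U U' : Subcat Γ} (F : CFunctor X U)
    (G : CFunctor X U') : Prop :=
  ∀ (x y : Γ.V) (a : W Γ x y) (h : a ∈ U.mor x y) (h' : a ∈ U'.mor x y),
    F.map ⟨a, h⟩ = G.map ⟨a, h'⟩

/-- An `n`-realization of initial data: a functor on the `n`-skeleton of `bWΓ` which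
represents the given homotopy class on each arrow of `Γ` except the maximal one. -/
structure Realization (A : InitialData.{u, v, w} Γ) (n : ℕ) where
  toFunctor : CFunctor A.obj (skeleton Γ n)
  class_eq : ∀ {x y : Γ.V} (h : ¬ (x = Γ.vinit ∧ y = Γ.vfin)) (f : Γ.Hom x y),
    (Quotient.mk _ (toFunctor.pmap ⟨W.arrow f, arrow_mem_skeleton n h f⟩) :
      HoMap (A.obj x) (A.obj y)) = A.map f

/-- `R'` extends `R`. -/
def Realization.Extends {A : InitialData.{u, v, w} Γ} {m n : ℕ} (R' : Realization A n)
    (R : Realization A m) : Prop :=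
  m ≤ n ∧ R'.toFunctor.Agree R.toFunctor

/-! ## Difference obstructions -/

section Difference

variable (X Y : PointedSpace.{w})

/-- Pointed maps `X ⋊ K → Y`, where `X ⋊ K = (X × K)/({pt} × K)`. -/
abbrev HalfSmashMap (K : Type) [TopologicalSpace K] :=
  {f : C(X × K, Y) // ∀ s : K, f (X.pt, s) = Y.pt}

/-- The relation on two copies of `C` that identifies the two copies of `B ⊆ C`. -/
inductive DoubleRel {C : Type} (B : Set C) : C × Bool → C × Bool → Prop
  | glue (c : C) (h : c ∈ B) : DoubleRel B (c, true) (c, false)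

/-- Two copies of `C` glued along `B`. For a cube and its boundary this is `Σ∂C`. -/
def Double {C : Type} (B : Set C) : Type := Quot (DoubleRel B)

instance {C : Type} [TopologicalSpace C] (B : Set C) : TopologicalSpace (Double B) :=
  inferInstanceAs (TopologicalSpace (Quot (DoubleRel B)))

/-- The projection from the two copies of `C`. -/
def Double.mk {C : Type} (B : Set C) (p : C × Bool) : Double B := Quot.mk _ p

/-- Maps out of the double. -/
def Double.lift {C : Type} {B : Set C} {Z : Type w} (f : C × Bool → Z)
    (h : ∀ c ∈ B, f (c, true) = f (c, false)) (d : Double B) : Z :=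
  Quot.lift f (by rintro _ _ ⟨c, hc⟩; exact h c hc) d

/-- The copy of `B` in the double. -/
def Double.base {C : Type} (B : Set C) : Set (Double B) :=
  {d | ∃ c ∈ B, d = Double.mk B (c, true)}

theorem Double.isProperMap_mk {C : Type} [TopologicalSpace C] [CompactSpace C] [T2Space C]
    {B : Set C} (hB : IsClosed B) :
    IsProperMap (Double.mk B) := by
  have hq : IsQuotientMap (Double.mk B) := isQuotientMap_quot_mk
  let fold : Double B → C := Quot.lift Prod.fst (by rintro _ _ ⟨c, h⟩; rfl)
  have hrel : ∀ p q : C × Bool, Double.mk B p = Double.mk B q →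
      p = q ∨ (p.1 = q.1 ∧ p.1 ∈ B) := by
    intro p q h
    have h1 : p.1 = q.1 := congrArg fold h
    by_cases hp : p.1 ∈ B
    · exact .inr ⟨h1, hp⟩
    · left
      let g : Double B → Prop := Quot.lift (fun r => r.1 ∈ B ∨ r.2 = true) (by
        rintro _ _ ⟨c, h⟩; simp [h])
      have h2 : (p.1 ∈ B ∨ p.2 = true) = (q.1 ∈ B ∨ q.2 = true) := congrArg g h
      rw [← h1] at h2
      simp only [hp, false_or, eq_iff_iff] at h2
      exact Prod.ext h1 (Bool.eq_iff_iff.2 h2)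
  have hsat : ∀ S : Set (C × Bool), (Double.mk B) ⁻¹'
      ((Double.mk B) '' S) =
        S ∪ Prod.fst ⁻¹' (B ∩ Prod.fst '' S) := by
    intro S
    ext q
    constructor
    · rintro ⟨p, hp, h⟩
      rcases hrel p q h with rfl | ⟨h1, h2⟩
      · exact .inl hp
      · exact .inr ⟨h1 ▸ h2, p, hp, h1⟩
    · rintro (h | ⟨h1, ⟨c, b⟩, hp, h2⟩)
      · exact ⟨q, h, rfl⟩
      · obtain ⟨d, b'⟩ := q
        change c = d at h2
        subst h2
        refine ⟨_, hp, ?_⟩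
        have : Double.mk B (c, true) = Double.mk B (c, false) := Quot.sound (.glue c h1)
        cases b <;> cases b' <;> simp [this]
  have hclosed : IsClosedMap (Double.mk B) := by
    intro S hS
    rw [← hq.isClosed_preimage, hsat]
    exact hS.union ((hB.inter (hS.isCompact.image continuous_fst).isClosed).preimage
      continuous_fst)
  refine isProperMap_iff_isClosedMap_and_compact_fibers.2 ⟨hq.continuous, hclosed, ?_⟩
  rintro ⟨p⟩
  have := hclosed {p} isClosed_singleton
  rw [Set.image_singleton] at this
  exact (this.preimage hq.continuous).isCompact

/-- The map `D : X ⋊ (C ∪_B C) → Y` defined by two maps `X ⋊ C → Y` that agree on `X ⋊ B`. -/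
def differenceMap {C : Type} [TopologicalSpace C] [CompactSpace C] [T2Space C] {B : Set C}
    (hB : IsClosed B) (F₁ F₂ : HalfSmashMap X Y C)
    (h : ∀ (s : X), ∀ c ∈ B, F₁.1 (s, c) = F₂.1 (s, c)) : HalfSmashMap X Y (Double B) where
  val :=
    { toFun := fun p => Double.lift
        (fun q : C × Bool => bif q.2 then F₁.1 (p.1, q.1) else F₂.1 (p.1, q.1)) (h p.1) p.2
      continuous_toFun := by
        have hq : IsQuotientMap (Prod.map (id : X → X)
            (Double.mk B)) :=
          (IsProperMap.prodMap isProperMap_id (Double.isProperMap_mk hB)).isClosedMap.isQuotientMap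
            (continuous_id.prodMap (Double.isProperMap_mk hB).continuous)
            (Function.surjective_id.prodMap Quot.mk_surjective)
        rw [hq.continuous_iff]
        have : Continuous fun p : (X × C) × Bool => bif p.2 then F₁.1 p.1 else F₂.1 p.1 :=
          continuous_prod_of_discrete_right.2 (by
            rintro (_ | _)
            · exact F₂.1.continuous
            · exact F₁.1.continuous)
        exact this.comp (f := fun p : X × (C × Bool) => ((p.1, p.2.1), p.2.2)) (by fun_prop) }
  property := by
    rintro ⟨c, _ | _⟩
    · exact F₂.2 c
    · exact F₁.2 c

/-- Homotopy of maps `X ⋊ (C ∪_B C) → Y` relative to `X ⋊ B`. -/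
def relSetoid {C : Type} [TopologicalSpace C] (B : Set C) :
    Setoid (HalfSmashMap X Y (Double B)) where
  r f g := ContinuousMap.HomotopicRel f.1 g.1 {p | p.1 = X.pt ∨ p.2 ∈ Double.base B}
  iseqv := ⟨fun f => .refl f.1, fun h => h.symm, fun h h' => h.trans h'⟩

/-- The set `[X ⋊ (C ∪_B C), Y (rel X ⋊ B)]`. -/
def DifferenceClass {C : Type} [TopologicalSpace C] (B : Set C) := Quotient (relSetoid X Y B)

variable {X Y}

/-- A map `X ⋊ K → Y` is null if, as a map from `K` to the space of pointed maps `X → Y`, it is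
homotopic to a constant map. -/
def HalfSmashMap.IsNull {K : Type} [TopologicalSpace K] (f : HalfSmashMap X Y K) : Prop :=
  ∃ g : PMap X Y, ContinuousMap.HomotopicRel f.1 (g.1.comp ContinuousMap.fst) {p | p.1 = X.pt}

/-- A class is null if its representatives are null; this does not depend on the representative. -/
def DifferenceClass.IsNull {C : Type} [TopologicalSpace C] {B : Set C}
    (δ : DifferenceClass X Y B) : Prop :=
  Quotient.lift (s := relSetoid X Y B) HalfSmashMap.IsNull (by
    have key : ∀ f g : HalfSmashMap X Y (Double B), (relSetoid X Y B).r f g →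
        f.IsNull → g.IsNull := by
      rintro f g ⟨H⟩ ⟨e, he⟩
      have H' : ContinuousMap.HomotopicRel f.1 g.1 {p | p.1 = X.pt} :=
        ⟨⟨H.toHomotopy, fun t x hx => H.prop' t x (.inl hx)⟩⟩
      exact ⟨e, H'.symm.trans he⟩
    intro f g h
    exact propext ⟨key f g h, key g f ((relSetoid X Y B).symm h)⟩) δ

/-- The boundary of the cube `I^n`. -/
def cubeBoundary (n : ℕ) : Set (Fin n → I) := {t | ∃ i, t i = 0 ∨ t i = 1}

theorem isClosed_cubeBoundary (n : ℕ) : IsClosed (cubeBoundary n) := by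
  have : cubeBoundary n = ⋃ i, {t : Fin n → I | t i = 0} ∪ {t | t i = 1} := by
    ext t; simp [cubeBoundary]
  rw [this]
  exact isClosed_iUnion_of_finite fun i =>
    (isClosed_eq (continuous_apply i) continuous_const).union
      (isClosed_eq (continuous_apply i) continuous_const)

/-- The difference obstruction of two maps on `X ⋊ I^n` that agree on `X ⋊ ∂I^n`. -/
def differenceObstruction {n : ℕ} (F₁ F₂ : HalfSmashMap X Y (Fin n → I))
    (h : ∀ (s : X), ∀ t ∈ cubeBoundary n, F₁.1 (s, t) = F₂.1 (s, t)) :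
    DifferenceClass X Y (cubeBoundary n) :=
  Quotient.mk _ (differenceMap X Y (isClosed_cubeBoundary n) F₁ F₂ h)

end Difference

/-! ## Obstruction sequences -/

/-- An indecomposable `n`-cube of `bWΓ`, given by its only factor `C[Ψ]` of positive dimension:
`Ψ` is a chain of `n + 1` arrows which does not run from `vinit` to `vfin`. -/
structure IndecCube (Γ : LatticeCat.{u, v}) (n : ℕ) where
  src : Γ.V
  tgt : Γ.V
  chain : Chain Γ src tgt
  dim_eq : chain.dim = n
  proper : ¬ (src = Γ.vinit ∧ tgt = Γ.vfin)

/-- The arrows of the sublattice of `Γ` generated by the arrows of a chain `Ψ`. -/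
inductive Generated {x y : Γ.V} (Ψ : Chain Γ x y) : ∀ {a b : Γ.V}, Γ.Hom a b → Prop
  | of {a b : Γ.V} (f : Γ.Hom a b) : ⟨a, b, f⟩ ∈ Ψ.arrows → Generated Ψ f
  | comp {a b c : Γ.V} (f : Γ.Hom a b) (g : Γ.Hom b c) :
      Generated Ψ f → Generated Ψ g → Generated Ψ (Γ.comp f g)

theorem WPt.arrows_append {x y z : Γ.V} (p : WPt Γ x y) (q : WPt Γ y z) :
    (p.append q).arrows = p.arrows ++ q.arrows := by
  induction p with
  | single f => rfl
  | cons f t p ih => simp [WPt.append, WPt.arrows, ih q]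

theorem WPt.arrows_mk {x y : Γ.V} (c : Chain Γ x y) (t : Fin c.dim → I) :
    (WPt.mk c t).arrows = c.arrows := by
  induction c with
  | single f => rfl
  | cons f c ih => simp [WPt.mk, WPt.arrows, Chain.arrows, ih]

/-- The subcategory `WΓ'` of `WΓ`, where `Γ'` is the sublattice generated by the arrows of `Ψ`. -/
def subW {x y : Γ.V} (Ψ : Chain Γ x y) : Subcat Γ where
  mor _ _ := {a | ∃ p, a = Quot.mk _ p ∧ ∀ f ∈ p.arrows, Generated Ψ f.2.2}
  comp_mem := by
    rintro _ _ _ _ _ ⟨p, rfl, hp⟩ ⟨q, rfl, hq⟩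
    refine ⟨p.append q, rfl, fun f hf => ?_⟩
    rw [WPt.arrows_append, List.mem_append] at hf
    exact hf.elim (hp f) (hq f)

/-- The chain `χ` lies in the sublattice `Γ'` generated by `Ψ`, i.e. `C[χ]` is a cube of `WΓ'`. For
`χ` with one arrow less than `Ψ` this says that `C[χ]` is a facet of `C[Ψ]`, up to the
zero-dimensional factor split off in a facet on which the first or the last parameter is `1`. -/
def IsSubchain {x y a b : Γ.V} (χ : Chain Γ a b) (Ψ : Chain Γ x y) : Prop :=
  ∀ f ∈ χ.arrows, Generated Ψ f.2.2

theorem cube_mem_subW {x y a b : Γ.V} {χ : Chain Γ a b} {Ψ : Chain Γ x y} (h : IsSubchain χ Ψ)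
    (t : Fin χ.dim → I) : W.cube χ t ∈ (subW Ψ).mor a b :=
  ⟨WPt.mk χ t, rfl, by rw [WPt.arrows_mk]; exact h⟩

theorem continuous_cube {x y : Γ.V} (c : Chain Γ x y) : Continuous (W.cube c) := by
  refine continuous_quot_mk.comp ?_
  rw [continuous_iff_coinduced_le]
  exact le_iSup (fun c : Chain Γ x y => TopologicalSpace.coinduced (WPt.mk c) inferInstance) c

theorem boundary_mem_skeleton {k : ℕ} (χ : IndecCube Γ k) {t : Fin χ.chain.dim → I}
    (ht : t ∈ cubeBoundary χ.chain.dim) :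
    W.cube χ.chain t ∈ (skeleton Γ (k - 1)).mor χ.src χ.tgt := by
  obtain ⟨i, hi⟩ := ht
  refine .face _ (.inl χ.proper) ⟨χ.chain, t, rfl, ?_⟩
  have hsub : {j | t j ≠ 0 ∧ t j ≠ 1} ⊆ Set.univ \ {i} := by
    rintro j ⟨h0, h1⟩
    refine ⟨trivial, ?_⟩
    rintro rfl
    exact hi.elim h0 h1
  refine (Set.ncard_le_ncard hsub).trans ?_
  rw [Set.ncard_sdiff_singleton_of_mem (Set.mem_univ i), Set.ncard_univ, Nat.card_fin, χ.dim_eq]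

/-- The restriction of a functor on `WΓ'` to one of its cubes, as a map `X ⋊ C[χ] → Y`. -/
def CFunctor.restrictCube {X : Γ.V → PointedSpace.{w}} {x y a b : Γ.V} {Ψ : Chain Γ x y}
    (F : CFunctor X (subW Ψ)) {χ : Chain Γ a b} (h : IsSubchain χ Ψ) :
    HalfSmashMap (X a) (X b) (Fin χ.dim → I) :=
  ⟨⟨fun p => F.map ⟨W.cube χ p.2, cube_mem_subW h p.2⟩ p.1,
    (F.continuous_map a b).comp (f := fun p : X a × (Fin χ.dim → I) =>
      ((p.1, ⟨W.cube χ p.2, cube_mem_subW h p.2⟩) : X a × (subW Ψ).mor a b))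
      (continuous_fst.prodMk (Continuous.subtype_mk ((continuous_cube χ).comp continuous_snd) _))⟩,
    fun _ => F.map_pt _⟩

/-- A choice, for each indecomposable `(k+1)`-cube `C_i = WΓ_i`, of a functor `F_i` on `WΓ_i`
extending the restriction of the given `(k-1)`-realization. -/
structure CubeExtensions {A : InitialData.{u, v, w} Γ} (k : ℕ) (R : Realization A (k - 1)) where
  functor : ∀ C : IndecCube Γ (k + 1), CFunctor A.obj (subW C.chain)
  extend : ∀ C : IndecCube Γ (k + 1), (functor C).Agree R.toFunctor

/-- Two distinct indecomposable `(k+1)`-cubes together with a common `k`-face. -/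
structure CommonFace (Γ : LatticeCat.{u, v}) (k : ℕ) where
  left : IndecCube Γ (k + 1)
  right : IndecCube Γ (k + 1)
  ne : left ≠ right
  face : IndecCube Γ k
  face_left : IsSubchain face.chain left.chain
  face_right : IsSubchain face.chain right.chain

/-- The obstruction sequence of a choice of functors: the family of the difference obstructions on
all common `k`-faces of pairs of indecomposable `(k+1)`-cubes. -/
def CubeExtensions.obstructionSequence {A : InitialData.{u, v, w} Γ} {k : ℕ}
    {R : Realization A (k - 1)} (F : CubeExtensions k R) (p : CommonFace Γ k) :
    DifferenceClass (A.obj p.face.src) (A.obj p.face.tgt) (cubeBoundary p.face.chain.dim) :=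
  differenceObstruction ((F.functor p.left).restrictCube p.face_left)
    ((F.functor p.right).restrictCube p.face_right) (by
      intro s t ht
      have h := boundary_mem_skeleton p.face ht
      exact (congrFun (F.extend p.left _ _ _ (cube_mem_subW p.face_left t) h) s).trans
        (congrFun (F.extend p.right _ _ _ (cube_mem_subW p.face_right t) h) s).symm)

/-- The obstruction sequence vanishes if each of its components is null. -/
def CubeExtensions.Vanishes {A : InitialData.{u, v, w} Γ} {k : ℕ} {R : Realization A (k - 1)}
    (F : CubeExtensions k R) : Prop :=
  ∀ p : CommonFace Γ k, (F.obstructionSequence p).IsNull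

end HHO

end

/-! A point of `bWΓ` factors uniquely into interior points of indecomposable cubes, so a functor on
a skeleton is the same as a family of maps on cubes that is compatible on their boundaries. The
restrictions of a `(k+1)`-realization to the `(k+1)`-cubes therefore have equal values on common
`k`-faces, and the difference of a map with itself factors through the contractible cube.
Conversely, a null difference obstruction says that the two maps on a common face `χ` are homotopic
relative to its boundary: a homotopy to a constant map can be made stationary on `∂C[χ]` by pushing
the interior of the cube off to the boundary while the homotopy runs. So one map on `C[χ]` can be
chosen for all cubes containing `χ`, and the homotopy extension property of `∂C[Ψ] ⊆ C[Ψ]` carries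
`F_Ψ` over to an extension of the new `k`-realization to `C[Ψ]`. -/

noncomputable section

open Topology
open scoped unitInterval

namespace HHO

variable {Γ : LatticeCat.{u, v}}

/-- Prefixing a morphism of `WΓ` by an arrow, with parameter `t` at the new node. -/
def W.cons {x y z : Γ.V} (f : Γ.Hom x y) (t : I) : W Γ y z → W Γ x z :=
  Quot.map (WPt.cons f t) fun _ _ h => .tail f t h

theorem W.cons_zero_arrow {x y z : Γ.V} (f : Γ.Hom x y) (g : Γ.Hom y z) :
    W.cons f 0 (W.arrow g) = W.arrow (Γ.comp f g) :=
  Quot.sound (.last f g)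

theorem W.cons_zero_cons {x y z s : Γ.V} (f : Γ.Hom x y) (g : Γ.Hom y z) (t : I) (a : W Γ z s) :
    W.cons f 0 (W.cons g t a) = W.cons (Γ.comp f g) t a := by
  induction a using Quot.ind with
  | mk p => exact Quot.sound (.inner f g t p)

theorem W.cons_comp {x y z s : Γ.V} (f : Γ.Hom x y) (t : I) (a : W Γ y z) (b : W Γ z s) :
    W.cons f t (a.comp b) = (W.cons f t a).comp b := by
  induction a using Quot.ind
  induction b using Quot.ind
  rfl

/-- The inverse of `WPt.mk`: the chain of a point, together with its position in the cube of this
chain. -/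
def WPt.toSigma : ∀ {x y : Γ.V}, WPt Γ x y → Σ c : Chain Γ x y, (Fin c.dim → I)
  | _, _, .single f => ⟨.single f, Fin.elim0⟩
  | _, _, .cons f t p =>
    ⟨.cons f p.toSigma.1, Fin.cons (n := p.toSigma.1.dim) (α := fun _ => I) t p.toSigma.2⟩

theorem WPt.mk_toSigma {x y : Γ.V} (p : WPt Γ x y) : WPt.mk p.toSigma.1 p.toSigma.2 = p := by
  induction p with
  | single f => rfl
  | cons f t p ih => exact congrArg (WPt.cons f t) ih

theorem WPt.toSigma_mk {x y : Γ.V} (c : Chain Γ x y) (t : Fin c.dim → I) :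
    (WPt.mk c t).toSigma = ⟨c, t⟩ := by
  induction c with
  | single f => exact congrArg (Sigma.mk _) (funext fun i => i.elim0)
  | @cons x y z f c ih =>
    let cons (q : Σ c : Chain Γ y z, (Fin c.dim → I)) : Σ c : Chain Γ x z, (Fin c.dim → I) :=
      ⟨.cons f q.1, Fin.cons (n := q.1.dim) (α := fun _ => I) (t (0 : Fin (c.dim + 1))) q.2⟩
    exact (congrArg cons (ih _)).trans
      (congrArg (Sigma.mk (Chain.cons f c)) (Fin.cons_self_tail (n := c.dim) t))

theorem WPt.mk_injective {x y : Γ.V} (c : Chain Γ x y) : Function.Injective (WPt.mk c) := by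
  intro t t' h
  have := congrArg WPt.toSigma h
  rwa [WPt.toSigma_mk, WPt.toSigma_mk, Sigma.mk.injEq, heq_eq_eq, and_iff_right rfl] at this

/-- The list of the parameters at the internal nodes. -/
def WPt.coords : ∀ {x y : Γ.V}, WPt Γ x y → List I
  | _, _, .single _ => []
  | _, _, .cons _ t p => t :: p.coords

theorem WPt.coords_append {x y z : Γ.V} (p : WPt Γ x y) (q : WPt Γ y z) :
    (p.append q).coords = p.coords ++ 1 :: q.coords := by
  induction p with
  | single f => rfl
  | cons f t p ih => simp only [WPt.append, WPt.coords, ih, List.cons_append]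

theorem WPt.coords_mk {x y : Γ.V} (c : Chain Γ x y) (t : Fin c.dim → I) :
    (WPt.mk c t).coords = List.ofFn t := by
  induction c with
  | single f => rfl
  | cons f c ih =>
    simp only [WPt.mk, WPt.coords, ih]
    exact (List.ofFn_succ (n := c.dim)).symm

theorem WPt.exists_append_of_one_mem {x y : Γ.V} {p : WPt Γ x y} (h : 1 ∈ p.coords) :
    ∃ (z : Γ.V) (q : WPt Γ x z) (r : WPt Γ z y), p = q.append r := by
  induction p with
  | single f => exact absurd h List.not_mem_nil
  | @cons x y z f t p ih =>
    rcases List.mem_cons.1 h with rfl | h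
    · exact ⟨y, .single f, p, rfl⟩
    · obtain ⟨z, q, r, rfl⟩ := ih h
      exact ⟨z, .cons f t q, r, rfl⟩

/-- Composing an arrow with the first arrow of a chain. -/
def WPt.absorb {x y : Γ.V} (f : Γ.Hom x y) : ∀ {z : Γ.V}, WPt Γ y z → WPt Γ x z
  | _, .single g => .single (Γ.comp f g)
  | _, .cons g t p => .cons (Γ.comp f g) t p

theorem WPt.absorb_absorb {x y z s : Γ.V} (f : Γ.Hom x y) (g : Γ.Hom y z) (p : WPt Γ z s) :
    (p.absorb g).absorb f = p.absorb (Γ.comp f g) := by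
  cases p <;> simp only [WPt.absorb, Γ.assoc]

theorem WPt.absorb_append {x y z s : Γ.V} (f : Γ.Hom x y) (p : WPt Γ y z) (q : WPt Γ z s) :
    (p.absorb f).append q = (p.append q).absorb f := by
  cases p <;> rfl

theorem WPt.coords_absorb {x y z : Γ.V} (f : Γ.Hom x y) (p : WPt Γ y z) :
    (p.absorb f).coords = p.coords := by
  cases p <;> rfl

theorem WPt.mk_absorb {x y z : Γ.V} (f : Γ.Hom x y) (p : WPt Γ y z) :
    (Quot.mk _ (p.absorb f) : W Γ x z) = W.cons f 0 (Quot.mk _ p) := by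
  cases p with
  | single g => exact (W.cons_zero_arrow f g).symm
  | cons g t p => exact (W.cons_zero_cons f g t (Quot.mk _ p)).symm

/-- The normal form of a point: the arrows at all internal nodes with parameter `0` are
composed. -/
def WPt.nf : ∀ {x y : Γ.V}, WPt Γ x y → WPt Γ x y
  | _, _, .single f => .single f
  | _, _, .cons f t p => if t = 0 then p.nf.absorb f else .cons f t p.nf

theorem WPt.Rel.nf_eq {x y : Γ.V} {p q : WPt Γ x y} (h : WPt.Rel p q) : p.nf = q.nf := by
  induction h with
  | last f g => simp only [WPt.nf, WPt.absorb, if_true]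
  | inner f g t p =>
    by_cases ht : t = 0
    · simp only [WPt.nf, ht, if_true, WPt.absorb_absorb]
    · simp only [WPt.nf, ht, if_true, if_false, WPt.absorb]
  | tail f t _ ih => simp only [WPt.nf, ih]

theorem WPt.nf_append {x y z : Γ.V} (p : WPt Γ x y) (q : WPt Γ y z) :
    (p.append q).nf = p.nf.append q.nf := by
  induction p with
  | single f => simp only [WPt.append, WPt.nf, one_ne_zero, if_false]
  | cons f t p ih =>
    by_cases ht : t = 0
    · simp only [WPt.append, WPt.nf, ht, if_true, ih, WPt.absorb_append]
    · simp only [WPt.append, WPt.nf, ht, if_false, ih]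

theorem WPt.coords_nf {x y : Γ.V} (p : WPt Γ x y) : p.nf.coords = p.coords.filter (· ≠ 0) := by
  induction p with
  | single f => rfl
  | cons f t p ih =>
    by_cases ht : t = 0
    · simp [WPt.nf, WPt.coords, ht, WPt.coords_absorb, ih]
    · simp [WPt.nf, WPt.coords, ht, ih]

theorem WPt.nf_eq_self {x y : Γ.V} {p : WPt Γ x y} (h : 0 ∉ p.coords) : p.nf = p := by
  induction p with
  | single f => rfl
  | cons f t p ih =>
    rw [WPt.coords, List.mem_cons, not_or] at h
    rw [WPt.nf, if_neg (Ne.symm h.1), ih h.2]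

theorem WPt.mk_nf {x y : Γ.V} (p : WPt Γ x y) : (Quot.mk _ p.nf : W Γ x y) = Quot.mk _ p := by
  induction p with
  | single f => rfl
  | cons f t p ih =>
    by_cases ht : t = 0
    · simp only [WPt.nf, ht, if_true, WPt.mk_absorb, ih]
      rfl
    · simp only [WPt.nf, ht, if_false]
      exact congrArg (W.cons f t) ih

/-- The unique representative of a morphism of `WΓ` without parameters equal to `0`. -/
def W.nf {x y : Γ.V} : W Γ x y → WPt Γ x y :=
  Quot.lift WPt.nf fun _ _ h => h.nf_eq

theorem W.mk_nf {x y : Γ.V} (a : W Γ x y) : Quot.mk _ a.nf = a := by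
  induction a using Quot.ind with
  | mk p => exact p.mk_nf

theorem W.nf_comp {x y z : Γ.V} (a : W Γ x y) (b : W Γ y z) :
    (a.comp b).nf = a.nf.append b.nf := by
  induction a using Quot.ind
  induction b using Quot.ind
  exact WPt.nf_append _ _

theorem W.nf_cube {x y : Γ.V} {c : Chain Γ x y} {t : Fin c.dim → I} (h : ∀ i, t i ≠ 0) :
    (W.cube c t).nf = WPt.mk c t :=
  WPt.nf_eq_self (by simpa only [WPt.coords_mk, List.mem_ofFn, not_exists] using h)

theorem W.cube_toSigma_nf {x y : Γ.V} (a : W Γ x y) :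
    W.cube a.nf.toSigma.1 a.nf.toSigma.2 = a := by
  rw [W.cube, WPt.mk_toSigma, W.mk_nf]

/-- The nonzero parameters of a morphism of `WΓ`. -/
def W.coords {x y : Γ.V} (a : W Γ x y) : List I := a.nf.coords

theorem W.coords_comp {x y z : Γ.V} (a : W Γ x y) (b : W Γ y z) :
    (a.comp b).coords = a.coords ++ 1 :: b.coords := by
  rw [W.coords, W.nf_comp, WPt.coords_append, W.coords, W.coords]

theorem W.coords_cube {x y : Γ.V} (c : Chain Γ x y) (t : Fin c.dim → I) :
    (W.cube c t).coords = (List.ofFn t).filter (· ≠ 0) := by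
  rw [← WPt.coords_mk, ← WPt.coords_nf]
  rfl

/-- A morphism of `WΓ` which is a composite of two morphisms. -/
def W.IsDecomposable {x y : Γ.V} (a : W Γ x y) : Prop :=
  ∃ (z : Γ.V) (b : W Γ x z) (c : W Γ z y), a = b.comp c

theorem W.isDecomposable_iff {x y : Γ.V} {a : W Γ x y} : a.IsDecomposable ↔ 1 ∈ a.coords := by
  constructor
  · rintro ⟨z, b, c, rfl⟩
    rw [W.coords_comp]
    exact List.mem_append_right _ List.mem_cons_self
  · intro h
    obtain ⟨z, q, r, hqr⟩ := WPt.exists_append_of_one_mem h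
    exact ⟨z, Quot.mk _ q, Quot.mk _ r, by rw [← a.mk_nf, hqr]; rfl⟩

theorem notMem_cubeBoundary {n : ℕ} {t : Fin n → I} :
    t ∉ cubeBoundary n ↔ (∀ i, t i ≠ 0) ∧ ∀ i, t i ≠ 1 := by
  simp only [cubeBoundary, Set.mem_ofPred_eq, not_exists, not_or, forall_and, ne_eq]

theorem W.not_isDecomposable_cube {x y : Γ.V} {c : Chain Γ x y} {t : Fin c.dim → I}
    (ht : t ∉ cubeBoundary c.dim) : ¬ (W.cube c t).IsDecomposable := by
  rw [W.isDecomposable_iff, W.coords_cube, List.mem_filter, List.mem_ofFn]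
  rintro ⟨⟨i, hi⟩, -⟩
  exact (notMem_cubeBoundary.1 ht).2 i hi

theorem W.exists_cube_of_not_isDecomposable {x y : Γ.V} {a : W Γ x y} (h : ¬ a.IsDecomposable) :
    ∃ (c : Chain Γ x y) (t : Fin c.dim → I), t ∉ cubeBoundary c.dim ∧ a = W.cube c t := by
  obtain ⟨c, t, rfl, hnf⟩ : ∃ (c : Chain Γ x y) (t : Fin c.dim → I),
      a = W.cube c t ∧ a.nf = WPt.mk c t :=
    ⟨_, _, a.cube_toSigma_nf.symm, a.nf.mk_toSigma.symm⟩
  have hcoords : List.ofFn t = (List.ofFn t).filter (· ≠ 0) := by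
    rw [← W.coords_cube, W.coords, hnf, WPt.coords_mk]
  refine ⟨c, t, notMem_cubeBoundary.2 ⟨fun i => ?_, fun i hi => h ?_⟩, rfl⟩
  · have : t i ∈ List.ofFn t := List.mem_ofFn.2 ⟨i, rfl⟩
    rw [hcoords, List.mem_filter] at this
    exact of_decide_eq_true this.2
  · rw [W.isDecomposable_iff, W.coords_cube, ← hcoords, ← hi]
    exact List.mem_ofFn.2 ⟨i, rfl⟩

theorem W.induction_interior {P : ∀ {x y : Γ.V}, W Γ x y → Prop}
    (interior : ∀ {x y : Γ.V} (c : Chain Γ x y) (t : Fin c.dim → I),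
      t ∉ cubeBoundary c.dim → P (W.cube c t))
    (comp : ∀ {x y z : Γ.V} (a : W Γ x y) (b : W Γ y z), P a → P b → P (a.comp b))
    {x y : Γ.V} (a : W Γ x y) : P a := by
  induction hn : a.coords.length using Nat.strong_induction_on generalizing x y with
  | _ n ih =>
    by_cases h : a.IsDecomposable
    · obtain ⟨z, b, c, rfl⟩ := h
      rw [W.coords_comp, List.length_append, List.length_cons] at hn
      exact comp b c (ih _ (by omega) b rfl) (ih _ (by omega) c rfl)
    · obtain ⟨c, t, ht, rfl⟩ := W.exists_cube_of_not_isDecomposable h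
      exact interior c t ht

theorem WPt.generated_nf {a b x y : Γ.V} {Ψ : Chain Γ a b} {p : WPt Γ x y}
    (h : ∀ f ∈ p.arrows, Generated Ψ f.2.2) : ∀ f ∈ p.nf.arrows, Generated Ψ f.2.2 := by
  have absorb {x y z : Γ.V} {f : Γ.Hom x y} {q : WPt Γ y z} (hf : Generated Ψ f)
      (hq : ∀ g ∈ q.arrows, Generated Ψ g.2.2) :
      ∀ g ∈ (q.absorb f).arrows, Generated Ψ g.2.2 := by
    cases q <;> rw [WPt.arrows, List.forall_mem_cons] at hq <;>
      exact List.forall_mem_cons.2 ⟨.comp _ _ hf hq.1, hq.2⟩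
  induction p with
  | single f => exact h
  | cons f t p ih =>
    rw [WPt.arrows, List.forall_mem_cons] at h
    rw [WPt.nf]
    split_ifs
    · exact absorb h.1 (ih h.2)
    · exact List.forall_mem_cons.2 ⟨h.1, ih h.2⟩

theorem mem_subW_iff {x y s z : Γ.V} {Ψ : Chain Γ x y} {a : W Γ s z} :
    a ∈ (subW Ψ).mor s z ↔ ∀ f ∈ a.nf.arrows, Generated Ψ f.2.2 := by
  constructor
  · rintro ⟨p, rfl, hp⟩
    exact WPt.generated_nf hp
  · exact fun h => ⟨a.nf, a.mk_nf.symm, h⟩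

theorem comp_mem_subW_iff {x y s z r : Γ.V} {Ψ : Chain Γ x y} {a : W Γ s z} {b : W Γ z r} :
    a.comp b ∈ (subW Ψ).mor s r ↔ a ∈ (subW Ψ).mor s z ∧ b ∈ (subW Ψ).mor z r := by
  simp only [mem_subW_iff, W.nf_comp, WPt.arrows_append, List.forall_mem_append]

theorem cube_mem_subW_iff {x y s z : Γ.V} {Ψ : Chain Γ x y} {c : Chain Γ s z}
    {t : Fin c.dim → I} (ht : t ∉ cubeBoundary c.dim) :
    W.cube c t ∈ (subW Ψ).mor s z ↔ IsSubchain c Ψ := by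
  rw [mem_subW_iff, W.nf_cube (notMem_cubeBoundary.1 ht).1, WPt.arrows_mk, IsSubchain]

/-- The number of parameters of a morphism of `WΓ` which are different from `0` and `1`, i.e. the
dimension of the smallest face that contains it. -/
def W.count {x y : Γ.V} (a : W Γ x y) : ℕ := a.coords.countP (· ≠ 1)

theorem W.count_comp {x y z : Γ.V} (a : W Γ x y) (b : W Γ y z) :
    (a.comp b).count = a.count + b.count := by
  simp [W.count, W.coords_comp]

theorem W.count_cube {x y : Γ.V} (c : Chain Γ x y) (t : Fin c.dim → I) :
    (W.cube c t).count = {i | t i ≠ 0 ∧ t i ≠ 1}.ncard := by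
  have hset : {i | t i ≠ 0 ∧ t i ≠ 1} =
      ((List.finRange c.dim).filter fun i => t i ≠ 1 ∧ t i ≠ 0).toFinset := by
    ext i
    simp [and_comm]
  rw [hset, Set.ncard_coe_finset, List.toFinset_card_of_nodup ((List.nodup_finRange _).filter _),
    W.count, W.coords_cube, List.ofFn_eq_map, List.countP_filter, List.countP_map,
    List.countP_eq_length_filter]
  simp [Function.comp_def]

theorem W.count_cube_le {x y : Γ.V} (c : Chain Γ x y) (t : Fin c.dim → I) :
    (W.cube c t).count ≤ c.dim := by
  rw [W.count_cube]
  exact (Set.ncard_le_card _).trans_eq (Nat.card_fin _)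

theorem W.count_cube_of_notMem_boundary {x y : Γ.V} {c : Chain Γ x y} {t : Fin c.dim → I}
    (ht : t ∉ cubeBoundary c.dim) : (W.cube c t).count = c.dim := by
  have hset : {i | t i ≠ 0 ∧ t i ≠ 1} = Set.univ :=
    Set.eq_univ_of_forall fun i => ⟨(notMem_cubeBoundary.1 ht).1 i, (notMem_cubeBoundary.1 ht).2 i⟩
  rw [W.count_cube, hset, Set.ncard_univ, Nat.card_fin]

theorem inFace_iff {k : ℕ} {x y : Γ.V} {a : W Γ x y} : InFace k a ↔ a.count ≤ k := by
  constructor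
  · rintro ⟨c, t, rfl, h⟩
    rwa [W.count_cube]
  · exact fun h => ⟨_, _, a.cube_toSigma_nf.symm, by rwa [← W.count_cube, W.cube_toSigma_nf]⟩

section Lift

variable {M : Γ.V → Γ.V → Type w} (mul : ∀ ⦃x y z : Γ.V⦄, M x y → M y z → M x z)
  (φ : ∀ ⦃x y : Γ.V⦄, W Γ x y → M x y)

/-- The value of `W.lift` on `pre p`, where `pre` prefixes the part of the current indecomposable
factor that has already been read. -/
def WPt.liftAux : ∀ {x y z : Γ.V}, (∀ s : Γ.V, W Γ y s → W Γ x s) → WPt Γ y z → M x z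
  | _, _, _, pre, .single f => φ (pre _ (W.arrow f))
  | _, _, _, pre, .cons f t p =>
    if t = 1 then mul (φ (pre _ (W.arrow f))) (WPt.liftAux (fun _ => id) p)
    else WPt.liftAux (fun s => pre s ∘ W.cons f t) p

theorem WPt.Rel.liftAux_eq {x y z : Γ.V} {p q : WPt Γ y z} (h : WPt.Rel p q)
    (pre : ∀ s : Γ.V, W Γ y s → W Γ x s) :
    p.liftAux mul φ pre = q.liftAux mul φ pre := by
  induction h generalizing x with
  | last f g =>
    simp only [WPt.liftAux, zero_ne_one, if_false, Function.comp_apply, W.cons_zero_arrow]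
  | inner f g t p =>
    simp only [WPt.liftAux, zero_ne_one, if_false, Function.comp_def, W.cons_zero_arrow,
      W.cons_zero_cons]
  | tail f t _ ih => simp only [WPt.liftAux, ih]

theorem WPt.liftAux_append
    (assoc : ∀ ⦃x y z s : Γ.V⦄ (a : M x y) (b : M y z) (c : M z s),
      mul (mul a b) c = mul a (mul b c))
    {x y z s : Γ.V} (p : WPt Γ y z) (q : WPt Γ z s) (pre : ∀ s : Γ.V, W Γ y s → W Γ x s) :
    (p.append q).liftAux mul φ pre = mul (p.liftAux mul φ pre) (q.liftAux mul φ fun _ => id) := by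
  induction p generalizing x with
  | single f => simp only [WPt.append, WPt.liftAux, if_true]
  | cons f t p ih =>
    simp only [WPt.append, WPt.liftAux, ih]
    split_ifs
    · rw [assoc]
    · rfl

theorem WPt.liftAux_of_one_notMem {x y z : Γ.V} {p : WPt Γ y z} (h : 1 ∉ p.coords)
    (pre : ∀ s : Γ.V, W Γ y s → W Γ x s) : p.liftAux mul φ pre = φ (pre z (Quot.mk _ p)) := by
  induction p generalizing x with
  | single f => rfl
  | cons f t p ih =>
    rw [WPt.coords, List.mem_cons, not_or] at h
    rw [WPt.liftAux, if_neg (Ne.symm h.1), ih h.2]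
    rfl

/-- `WΓ` is free on its indecomposable morphisms: the multiplicative extension of the restriction
of `φ` to these. -/
def W.lift {x y : Γ.V} : W Γ x y → M x y :=
  Quot.lift (WPt.liftAux mul φ fun _ => id) fun _ _ h => h.liftAux_eq mul φ _

theorem W.lift_comp
    (assoc : ∀ ⦃x y z s : Γ.V⦄ (a : M x y) (b : M y z) (c : M z s),
      mul (mul a b) c = mul a (mul b c))
    {x y z : Γ.V} (a : W Γ x y) (b : W Γ y z) :
    (a.comp b).lift mul φ = mul (a.lift mul φ) (b.lift mul φ) := by
  induction a using Quot.ind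
  induction b using Quot.ind
  exact WPt.liftAux_append mul φ assoc _ _ _

theorem W.lift_of_not_isDecomposable {x y : Γ.V} {a : W Γ x y} (h : ¬ a.IsDecomposable) :
    a.lift mul φ = φ a := by
  rw [W.isDecomposable_iff] at h
  conv_lhs => rw [← a.mk_nf]
  exact (WPt.liftAux_of_one_notMem mul φ h _).trans (congrArg (@φ x y) a.mk_nf)

end Lift

theorem LatticeCat.isEmpty_hom_vinit (x : Γ.V) : IsEmpty (Γ.Hom x Γ.vinit) := by
  refine ⟨fun f => ?_⟩
  by_cases h : x = Γ.vinit
  · subst h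
    exact (Γ.directed _).false f
  · obtain ⟨g⟩ := Γ.weak_initial x h
    exact (Γ.directed _).false (Γ.comp g f)

theorem LatticeCat.isEmpty_hom_vfin (x : Γ.V) : IsEmpty (Γ.Hom Γ.vfin x) := by
  refine ⟨fun f => ?_⟩
  by_cases h : x = Γ.vfin
  · subst h
    exact (Γ.directed _).false f
  · obtain ⟨g⟩ := Γ.weak_terminal x h
    exact (Γ.directed _).false (Γ.comp f g)

theorem W.nonempty_hom {x y : Γ.V} (a : W Γ x y) : Nonempty (Γ.Hom x y) := by
  induction a using Quot.ind with
  | mk p =>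
    induction p with
    | single f => exact ⟨f⟩
    | cons f _ _ ih => exact ih.map (Γ.comp f)

theorem W.target_ne_vinit {x y : Γ.V} (a : W Γ x y) : y ≠ Γ.vinit := by
  rintro rfl
  exact (LatticeCat.isEmpty_hom_vinit x).elim a.nonempty_hom.some

theorem W.source_ne_vfin {x y : Γ.V} (a : W Γ x y) : x ≠ Γ.vfin := by
  rintro rfl
  exact (LatticeCat.isEmpty_hom_vfin y).elim a.nonempty_hom.some

theorem IsBasic.of_not_isDecomposable {x y : Γ.V} {a : W Γ x y} (h : IsBasic a)
    (ha : ¬ a.IsDecomposable) : ¬ (x = Γ.vinit ∧ y = Γ.vfin) :=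
  h.resolve_right fun ⟨z, _, _, h⟩ => ha ⟨z, h⟩

theorem inSkeleton_of_count_le {k : ℕ} {x y : Γ.V} {a : W Γ x y}
    (h : ¬ (x = Γ.vinit ∧ y = Γ.vfin)) (hk : a.count ≤ k) : InSkeleton k a :=
  .face _ (.inl h) (inFace_iff.2 hk)

theorem InSkeleton.mono {k m : ℕ} (hkm : k ≤ m) {x y : Γ.V} {a : W Γ x y} (h : InSkeleton k a) :
    InSkeleton m a := by
  induction h with
  | face a hb hf => exact .face a hb (inFace_iff.2 ((inFace_iff.1 hf).trans hkm))
  | comp a b _ _ iha ihb => exact .comp a b iha ihb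

/-- All indecomposable factors of the morphism lie on faces of dimension at most `k` of `bWΓ`. -/
def W.FactorsInSkeleton (k : ℕ) {x y : Γ.V} (a : W Γ x y) : Prop :=
  a.lift (M := fun _ _ => Prop) (fun _ _ _ => And) fun x y b =>
    ¬ (x = Γ.vinit ∧ y = Γ.vfin) ∧ b.count ≤ k

theorem W.factorsInSkeleton_comp_iff {k : ℕ} {x y z : Γ.V} {a : W Γ x y} {b : W Γ y z} :
    (a.comp b).FactorsInSkeleton k ↔ a.FactorsInSkeleton k ∧ b.FactorsInSkeleton k :=
  iff_of_eq (W.lift_comp _ _ (fun _ _ _ _ _ _ _ => propext and_assoc) a b)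

theorem W.factorsInSkeleton_iff_of_not_isDecomposable {k : ℕ} {x y : Γ.V} {a : W Γ x y}
    (h : ¬ a.IsDecomposable) :
    a.FactorsInSkeleton k ↔ ¬ (x = Γ.vinit ∧ y = Γ.vfin) ∧ a.count ≤ k :=
  iff_of_eq (W.lift_of_not_isDecomposable _ _ h)

theorem W.factorsInSkeleton_of_isBasic {k : ℕ} {x y : Γ.V} {a : W Γ x y} (ha : IsBasic a)
    (hk : a.count ≤ k) : a.FactorsInSkeleton k := by
  induction a using W.induction_interior with
  | interior c t ht =>
    have h := W.not_isDecomposable_cube ht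
    exact (W.factorsInSkeleton_iff_of_not_isDecomposable h).2 ⟨ha.of_not_isDecomposable h, hk⟩
  | comp a b iha ihb =>
    rw [W.count_comp] at hk
    exact W.factorsInSkeleton_comp_iff.2
      ⟨iha (.inl fun h => b.source_ne_vfin h.2) (by omega),
        ihb (.inl fun h => a.target_ne_vinit h.1) (by omega)⟩

theorem inSkeleton_iff_factorsInSkeleton {k : ℕ} {x y : Γ.V} {a : W Γ x y} :
    InSkeleton k a ↔ a.FactorsInSkeleton k := by
  constructor
  · intro h
    induction h with
    | face a hb hf => exact W.factorsInSkeleton_of_isBasic hb (inFace_iff.1 hf)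
    | comp a b _ _ iha ihb => exact W.factorsInSkeleton_comp_iff.2 ⟨iha, ihb⟩
  · induction a using W.induction_interior with
    | interior c t ht =>
      intro h
      obtain ⟨hxy, hk⟩ :=
        (W.factorsInSkeleton_iff_of_not_isDecomposable (W.not_isDecomposable_cube ht)).1 h
      exact inSkeleton_of_count_le hxy hk
    | comp a b iha ihb =>
      intro h
      rw [W.factorsInSkeleton_comp_iff] at h
      exact .comp a b (iha h.1) (ihb h.2)

theorem inSkeleton_comp_iff {k : ℕ} {x y z : Γ.V} {a : W Γ x y} {b : W Γ y z} :
    InSkeleton k (a.comp b) ↔ InSkeleton k a ∧ InSkeleton k b := by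
  simp only [inSkeleton_iff_factorsInSkeleton, W.factorsInSkeleton_comp_iff]

theorem inSkeleton_cube_iff {k : ℕ} {x y : Γ.V} {c : Chain Γ x y} {t : Fin c.dim → I}
    (ht : t ∉ cubeBoundary c.dim) :
    InSkeleton k (W.cube c t) ↔ ¬ (x = Γ.vinit ∧ y = Γ.vfin) ∧ c.dim ≤ k := by
  rw [inSkeleton_iff_factorsInSkeleton, W.factorsInSkeleton_iff_of_not_isDecomposable
    (W.not_isDecomposable_cube ht), W.count_cube_of_notMem_boundary ht]

theorem cube_mem_skeleton {k : ℕ} {x y : Γ.V} {c : Chain Γ x y}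
    (hc : ¬ (x = Γ.vinit ∧ y = Γ.vfin)) (hk : c.dim ≤ k) (t : Fin c.dim → I) :
    W.cube c t ∈ (skeleton Γ k).mor x y :=
  inSkeleton_of_count_le hc ((W.count_cube_le c t).trans hk)

theorem Chain.exists_facet_zero {x y : Γ.V} (c : Chain Γ x y) (i : Fin c.dim) :
    ∃ (c' : Chain Γ x y) (π : Fin c'.dim → Fin c.dim), c'.dim < c.dim ∧
      ∀ t : Fin c.dim → I, t i = 0 → W.cube c t = W.cube c' (t ∘ π) := by
  induction c with
  | single f => exact i.elim0
  | @cons x y z f c ih =>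
    refine Fin.cases (n := c.dim) ?_ (fun j => ?_) i
    · cases c with
      | single g =>
        refine ⟨.single (Γ.comp f g), Fin.elim0, Nat.zero_lt_one, fun t ht => ?_⟩
        exact (congrArg (fun r => W.cons f r (W.arrow g)) ht).trans (W.cons_zero_arrow f g)
      | cons g c =>
        refine ⟨.cons (Γ.comp f g) c, Fin.succ (n := c.dim + 1), Nat.lt_succ_self _,
          fun t ht => ?_⟩
        exact (congrArg (fun r => W.cons f r (W.cube (.cons g c) (Fin.tail (n := c.dim + 1) t)))
          ht).trans (W.cons_zero_cons f g (Fin.tail (n := c.dim + 1) t 0)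
            (W.cube c (Fin.tail (n := c.dim) (Fin.tail (n := c.dim + 1) t))))
    · obtain ⟨c', π, hd, h⟩ := ih j
      refine ⟨.cons f c', Fin.cons (n := c'.dim) (α := fun _ => Fin (c.dim + 1)) 0
        (Fin.succ ∘ π), Nat.succ_lt_succ hd, fun t ht => ?_⟩
      exact congrArg (W.cons f _) (h (Fin.tail (n := c.dim) t) ht)

theorem Chain.exists_facet_one {x y : Γ.V} (c : Chain Γ x y) (i : Fin c.dim) :
    ∃ (z : Γ.V) (c₁ : Chain Γ x z) (c₂ : Chain Γ z y) (π₁ : Fin c₁.dim → Fin c.dim)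
      (π₂ : Fin c₂.dim → Fin c.dim), c₁.dim < c.dim ∧ c₂.dim < c.dim ∧
      ∀ t : Fin c.dim → I, t i = 1 →
        W.cube c t = (W.cube c₁ (t ∘ π₁)).comp (W.cube c₂ (t ∘ π₂)) := by
  induction c with
  | single f => exact i.elim0
  | @cons x y z f c ih =>
    refine Fin.cases (n := c.dim) ?_ (fun j => ?_) i
    · refine ⟨y, .single f, c, Fin.elim0, Fin.succ, Nat.succ_pos _, Nat.lt_succ_self _,
        fun t ht => ?_⟩
      exact congrArg (fun r => W.cons f r (W.cube c (Fin.tail (n := c.dim) t))) ht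
    · obtain ⟨s, c₁, c₂, π₁, π₂, h₁, h₂, h⟩ := ih j
      refine ⟨s, .cons f c₁, c₂, Fin.cons (n := c₁.dim) (α := fun _ => Fin (c.dim + 1)) 0
        (Fin.succ ∘ π₁), Fin.succ ∘ π₂, Nat.succ_lt_succ h₁, h₂.trans (Nat.lt_succ_self _),
        fun t ht => ?_⟩
      exact (congrArg (W.cons f _) (h (Fin.tail (n := c.dim) t) ht)).trans
        (W.cons_comp f _ _ _)

theorem Chain.finite (x y : Γ.V) : Finite (Chain Γ x y) := by
  have := Γ.finV
  have := Γ.finHom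
  let r : Γ.V → Γ.V → Prop := fun a b => Nonempty (Γ.Hom b a)
  have : IsTrans Γ.V r := ⟨fun a b c ⟨f⟩ ⟨g⟩ => ⟨Γ.comp g f⟩⟩
  have : Std.Irrefl r := ⟨fun a ⟨f⟩ => (Γ.directed a).false f⟩
  induction x using (Finite.wellFounded_of_trans_of_irrefl r).induction with
  | _ x ih =>
    have : ∀ p : Σ z, Γ.Hom x z, Finite (Chain Γ p.1 y) := fun p => ih p.1 ⟨p.2⟩
    let e : Γ.Hom x y ⊕ (Σ p : Σ z, Γ.Hom x z, Chain Γ p.1 y) → Chain Γ x y :=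
      Sum.elim .single fun q => .cons q.1.2 q.2
    refine Finite.of_surjective e fun c => ?_
    cases c with
    | single f => exact ⟨.inl f, rfl⟩
    | cons f c => exact ⟨.inr ⟨⟨_, f⟩, c⟩, rfl⟩

theorem WPt.isClosed_mk_eq_mk {x y : Γ.V} (c c' : Chain Γ x y) :
    IsClosed {p : (Fin c.dim → I) × (Fin c'.dim → I) | WPt.mk c p.1 = WPt.mk c' p.2} := by
  by_cases hc : c = c'
  · subst hc
    simp only [(WPt.mk_injective c).eq_iff]
    exact isClosed_eq continuous_fst continuous_snd
  · convert isClosed_empty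
    refine Set.eq_empty_of_forall_notMem fun p (hp : WPt.mk c p.1 = WPt.mk c' p.2) => hc ?_
    have := congrArg (fun q => q.toSigma.1) hp
    rwa [WPt.toSigma_mk, WPt.toSigma_mk] at this

theorem W.cube_eq_cube_iff {x y : Γ.V} {c c' : Chain Γ x y} {t : Fin c.dim → I}
    {t' : Fin c'.dim → I} :
    W.cube c t = W.cube c' t' ↔ WPt.mk c t = WPt.mk c' t' ∨
      (∃ i, t i = 0 ∧ W.cube c t = W.cube c' t') ∨ ∃ i, t' i = 0 ∧ W.cube c t = W.cube c' t' := by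
  constructor
  · intro h
    by_cases h0 : ∃ i, t i = 0
    · exact .inr (.inl (h0.imp fun i hi => ⟨hi, h⟩))
    by_cases h0' : ∃ i, t' i = 0
    · exact .inr (.inr (h0'.imp fun i hi => ⟨hi, h⟩))
    push Not at h0 h0'
    rw [← W.nf_cube h0, ← W.nf_cube h0']
    exact .inl (congrArg W.nf h)
  · rintro (h | ⟨-, -, h⟩ | ⟨-, -, h⟩)
    exacts [congrArg (Quot.mk _) h, h, h]

theorem W.isClosed_facet_eq_cube {x y : Γ.V} {c c' : Chain Γ x y} (i : Fin c.dim)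
    (h : ∀ d : Chain Γ x y, d.dim < c.dim →
      IsClosed {p : (Fin d.dim → I) × (Fin c'.dim → I) | W.cube d p.1 = W.cube c' p.2}) :
    IsClosed {p : (Fin c.dim → I) × (Fin c'.dim → I) |
      p.1 i = 0 ∧ W.cube c p.1 = W.cube c' p.2} := by
  obtain ⟨d, π, hd, hπ⟩ := c.exists_facet_zero i
  have hpull : {p : (Fin c.dim → I) × (Fin c'.dim → I) |
      p.1 i = 0 ∧ W.cube c p.1 = W.cube c' p.2} =
      {p | p.1 i = 0} ∩ (fun p => (p.1 ∘ π, p.2)) ⁻¹' {p | W.cube d p.1 = W.cube c' p.2} := by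
    ext ⟨t, t'⟩
    exact and_congr_right fun hi => by rw [hπ t hi]; rfl
  rw [hpull]
  exact (isClosed_eq (by fun_prop) continuous_const).inter ((h d hd).preimage (by fun_prop))

theorem W.isClosed_cube_eq_cube {x y : Γ.V} (c c' : Chain Γ x y) :
    IsClosed {p : (Fin c.dim → I) × (Fin c'.dim → I) | W.cube c p.1 = W.cube c' p.2} := by
  induction hn : c.dim + c'.dim using Nat.strong_induction_on generalizing c c' with
  | _ n ih =>
    have left (i : Fin c.dim) := W.isClosed_facet_eq_cube i fun d hd =>
      ih (d.dim + c'.dim) (by omega) d c' rfl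
    have right (i : Fin c'.dim) := (W.isClosed_facet_eq_cube i fun d hd =>
      ih (d.dim + c.dim) (by omega) d c rfl).preimage continuous_swap
    have hunion := (WPt.isClosed_mk_eq_mk c c').union
      ((isClosed_iUnion_of_finite left).union (isClosed_iUnion_of_finite right))
    convert hunion using 1
    ext ⟨t, t'⟩
    simp only [Set.mem_union, Set.mem_iUnion, Set.mem_preimage, Set.mem_ofPred_eq,
      Prod.swap_prod_mk, eq_comm (a := W.cube c' t')]
    exact W.cube_eq_cube_iff

theorem W.isClosed_iff {x y : Γ.V} {S : Set (W Γ x y)} :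
    IsClosed S ↔ ∀ c : Chain Γ x y, IsClosed (W.cube c ⁻¹' S) := by
  have hq : IsQuotientMap (Quot.mk (WPt.Rel (Γ := Γ) (x := x) (y := y))) := isQuotientMap_quot_mk
  refine hq.isClosed_preimage.symm.trans ?_
  rw [isClosed_iSup_iff]
  exact forall_congr' fun c => isClosed_coinduced

theorem W.isProperMap_cube {x y : Γ.V} (c : Chain Γ x y) : IsProperMap (W.cube c) := by
  refine isProperMap_iff_isClosedMap_and_compact_fibers.2 ⟨continuous_cube c, fun S hS => ?_,
    fun a => ?_⟩
  · refine W.isClosed_iff.2 fun c' => ?_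
    have hpre : W.cube c' ⁻¹' (W.cube c '' S) = Prod.snd '' ((Prod.fst ⁻¹' S) ∩
        {p : (Fin c.dim → I) × (Fin c'.dim → I) | W.cube c p.1 = W.cube c' p.2}) := by
      ext t'
      simp [and_assoc]
    rw [hpre]
    exact (((hS.preimage continuous_fst).inter
      (W.isClosed_cube_eq_cube c c')).isCompact.image continuous_snd).isClosed
  · rw [← a.cube_toSigma_nf]
    exact ((W.isClosed_cube_eq_cube c _).preimage (Continuous.prodMk_left _)).isCompact

theorem W.continuous_of_cube {x y : Γ.V} {X Y : Type*} [TopologicalSpace X] [TopologicalSpace Y]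
    {U : Set (W Γ x y)} {g : X → W Γ x y → Y}
    (h : ∀ c : Chain Γ x y, Continuous fun p : X × (W.cube c ⁻¹' U) => g p.1 (W.cube c p.2)) :
    Continuous fun p : X × U => g p.1 p.2 := by
  have := Chain.finite x y
  refine continuous_iff_isClosed.2 fun K hK => ?_
  have himage : (fun p : X × U => g p.1 p.2) ⁻¹' K =
      ⋃ c : Chain Γ x y, Prod.map id (U.restrictPreimage (W.cube c)) ''
        ((fun p : X × (W.cube c ⁻¹' U) => g p.1 (W.cube c p.2)) ⁻¹' K) := by
    ext ⟨s, a, ha⟩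
    simp only [Set.mem_preimage, Set.mem_iUnion, Set.mem_image]
    constructor
    · intro hs
      rw [← a.cube_toSigma_nf] at hs ha
      exact ⟨_, (s, ⟨_, ha⟩), hs, Prod.ext rfl (Subtype.ext a.cube_toSigma_nf)⟩
    · rintro ⟨c, ⟨s', t, ht⟩, hs, h'⟩
      cases h'
      exact hs
  rw [himage]
  exact isClosed_iUnion_of_finite fun c =>
    (isProperMap_id.prodMap ((W.isProperMap_cube c).restrictPreimage U)).isClosedMap _
      (hK.preimage (h c))

theorem continuous_of_facets {n : ℕ} {Q Z : Type*} [TopologicalSpace Q] [TopologicalSpace Z]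
    {θ : Q → Fin n → I} (hθ : Continuous θ) (hb : ∀ τ, θ τ ∈ cubeBoundary n) {f : Q → Z}
    (hf : ∀ i, ∀ e ∈ ({0, 1} : Set I), ContinuousOn f {τ | θ τ i = e}) : Continuous f := by
  refine (locallyFinite_of_finite fun p : Fin n × ({0, 1} : Set I) =>
    {τ | θ τ p.1 = p.2}).continuous ?_ (fun p => ?_) fun p => hf p.1 p.2 p.2.2
  · refine Set.eq_univ_of_forall fun τ => Set.mem_iUnion.2 ?_
    obtain ⟨i, hi⟩ := hb τ
    exact ⟨(i, ⟨θ τ i, hi⟩), rfl⟩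
  · exact isClosed_eq ((continuous_apply p.1).comp hθ) continuous_const

section Continuity

variable {X : Γ.V → Type w} [∀ x, TopologicalSpace (X x)] {T : Type*} [TopologicalSpace T]
  {E : T → ∀ ⦃x y : Γ.V⦄, W Γ x y → X x → X y} {m : ℕ}

theorem continuous_along_cube
    (map_comp : ∀ (q : T) {x y z : Γ.V} (a : W Γ x y) (b : W Γ y z),
      E q (a.comp b) = E q b ∘ E q a)
    (cont : ∀ {x y : Γ.V} (c : Chain Γ x y), ¬ (x = Γ.vinit ∧ y = Γ.vfin) → c.dim ≤ m →
      Continuous fun p : (T × X x) × (Fin c.dim → I) => E p.1.1 (W.cube c p.2) p.1.2)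
    {x y : Γ.V} (c : Chain Γ x y) {Q : Type*} [TopologicalSpace Q] {r : Q → T}
    (hr : Continuous r) {ρ : Q → X x} (hρ : Continuous ρ) {θ : Q → Fin c.dim → I}
    (hθ : Continuous θ) (hmem : ∀ τ, InSkeleton m (W.cube c (θ τ))) :
    Continuous fun τ => E (r τ) (W.cube c (θ τ)) (ρ τ) := by
  induction hn : c.dim using Nat.strong_induction_on generalizing x y c Q with
  | _ n ih =>
    by_cases hc : ¬ (x = Γ.vinit ∧ y = Γ.vfin) ∧ c.dim ≤ m
    · exact (cont c hc.1 hc.2).comp ((hr.prodMk hρ).prodMk hθ)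
    have hb (τ : Q) : θ τ ∈ cubeBoundary c.dim := by
      by_contra hint
      exact hc ((inSkeleton_cube_iff hint).1 (hmem τ))
    refine continuous_of_facets hθ hb fun i e he => ?_
    rw [continuousOn_iff_continuous_domRestrict]
    replace hr : Continuous fun τ : {τ | θ τ i = e} => r τ := hr.comp continuous_subtype_val
    replace hρ : Continuous fun τ : {τ | θ τ i = e} => ρ τ := hρ.comp continuous_subtype_val
    have hsub {l : ℕ} (π : Fin l → Fin c.dim) :
        Continuous fun τ : {τ | θ τ i = e} => θ τ ∘ π := by fun_prop
    obtain rfl | rfl := he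
    · obtain ⟨d, π, hd, hπ⟩ := c.exists_facet_zero i
      have hcube (τ : {τ | θ τ i = 0}) : W.cube c (θ τ) = W.cube d (θ τ ∘ π) := hπ _ τ.2
      refine (ih d.dim (hn ▸ hd) d hr hρ (hsub π) (fun τ => hcube τ ▸ hmem τ) rfl).congr
        fun τ => ?_
      rw [Set.domRestrict_apply, hcube]
    · obtain ⟨z, c₁, c₂, π₁, π₂, hd₁, hd₂, hπ⟩ := c.exists_facet_one i
      have hcube (τ : {τ | θ τ i = 1}) :
          W.cube c (θ τ) = (W.cube c₁ (θ τ ∘ π₁)).comp (W.cube c₂ (θ τ ∘ π₂)) := hπ _ τ.2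
      have hmem' (τ : {τ | θ τ i = 1}) := inSkeleton_comp_iff.1 (hcube τ ▸ hmem τ)
      have h₁ := ih c₁.dim (hn ▸ hd₁) c₁ hr hρ (hsub π₁) (fun τ => (hmem' τ).1) rfl
      refine (ih c₂.dim (hn ▸ hd₂) c₂ hr h₁ (hsub π₂) (fun τ => (hmem' τ).2) rfl).congr
        fun τ => ?_
      rw [Set.domRestrict_apply, hcube, map_comp, Function.comp_apply]

theorem continuous_skeleton_of_cubes
    (map_comp : ∀ (r : T) {x y z : Γ.V} (a : W Γ x y) (b : W Γ y z),
      E r (a.comp b) = E r b ∘ E r a)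
    (cont : ∀ {x y : Γ.V} (c : Chain Γ x y), ¬ (x = Γ.vinit ∧ y = Γ.vfin) → c.dim ≤ m →
      Continuous fun p : (T × X x) × (Fin c.dim → I) => E p.1.1 (W.cube c p.2) p.1.2)
    (x y : Γ.V) :
    Continuous fun p : (T × X x) × (skeleton Γ m).mor x y => E p.1.1 (p.2 : W Γ x y) p.1.2 :=
  W.continuous_of_cube (g := fun (q : T × X x) a => E q.1 a q.2) fun c =>
    continuous_along_cube map_comp cont c (continuous_fst.comp continuous_fst)
      (continuous_snd.comp continuous_fst) (continuous_subtype_val.comp continuous_snd)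
      fun p => p.2.2

end Continuity

section Functors

variable {X : Γ.V → PointedSpace.{w}} {U : Subcat Γ} {n : ℕ}

/-- Joint continuity of a family of functors in the parameter, the point and the morphism: for
`T = I` such a family is a homotopy of functors. -/
def CFunctor.IsContinuousFamily {T : Type*} [TopologicalSpace T] (E : T → CFunctor X U) : Prop :=
  ∀ x y : Γ.V, Continuous fun p : (T × X x) × U.mor x y => (E p.1.1).map p.2 p.1.2

/-- The restriction of a functor on the `n`-skeleton to an indecomposable `n`-cube. -/
def CFunctor.onCube (F : CFunctor X (skeleton Γ n)) (C : IndecCube Γ n) :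
    HalfSmashMap (X C.src) (X C.tgt) (Fin C.chain.dim → I) :=
  ⟨⟨fun p => F.map ⟨W.cube C.chain p.2, cube_mem_skeleton C.proper C.dim_eq.le p.2⟩ p.1,
    (F.continuous_map _ _).comp (continuous_fst.prodMk
      (Continuous.subtype_mk ((continuous_cube C.chain).comp continuous_snd) _))⟩,
    fun _ => F.map_pt _⟩

/-- The map `g` on an `(n+1)`-cube extends the functor `F` from the boundary of this cube. -/
def CFunctor.IsFilling (F : CFunctor X (skeleton Γ n)) (C : IndecCube Γ (n + 1))
    (g : HalfSmashMap (X C.src) (X C.tgt) (Fin C.chain.dim → I)) : Prop :=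
  ∀ (s : X C.src) (t : Fin C.chain.dim → I) (ht : t ∈ cubeBoundary C.chain.dim),
    g.1 (s, t) = F.map ⟨W.cube C.chain t, boundary_mem_skeleton C ht⟩ s

theorem CFunctor.agree_of_agree_on_cubes {R : CFunctor X (skeleton Γ n)}
    {E : CFunctor X (skeleton Γ (n + 1))} {F : CFunctor X U}
    (hU : ∀ {x y z : Γ.V} {a : W Γ x y} {b : W Γ y z}, a.comp b ∈ U.mor x z →
      a ∈ U.mor x y ∧ b ∈ U.mor y z)
    (hE : E.Agree R) (hF : F.Agree R)
    (h : ∀ (C : IndecCube Γ (n + 1)) (s : X C.src), ∀ t ∉ cubeBoundary C.chain.dim,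
      ∀ ht : W.cube C.chain t ∈ U.mor C.src C.tgt,
        (E.onCube C).1 (s, t) = F.map ⟨W.cube C.chain t, ht⟩ s) : E.Agree F := by
  intro x y a
  induction a using W.induction_interior with
  | @interior x y c t ht =>
    intro hm hm'
    obtain ⟨hxy, hd⟩ := (inSkeleton_cube_iff ht).1 hm
    rcases hd.eq_or_lt with hd | hd
    · exact funext fun s => h ⟨x, y, c, hd, hxy⟩ s t ht hm'
    · have hs := (inSkeleton_cube_iff ht).2 ⟨hxy, Nat.lt_succ_iff.1 hd⟩
      exact (hE x y _ hm hs).trans (hF x y _ hm' hs).symm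
  | comp a b iha ihb =>
    intro hm hm'
    obtain ⟨ha, hb⟩ := inSkeleton_comp_iff.1 hm
    obtain ⟨ha', hb'⟩ := hU hm'
    funext s
    rw [E.map_comp ⟨a, ha⟩ ⟨b, hb⟩, F.map_comp ⟨a, ha'⟩ ⟨b, hb'⟩, iha ha ha', ihb hb hb']

/-- The value of `G` at a point of a cube; on cubes other than the indecomposable `(n+1)`-cubes it
is constant. -/
def cubeValue
    (G : ∀ C : IndecCube Γ (n + 1), HalfSmashMap (X C.src) (X C.tgt) (Fin C.chain.dim → I))
    {x y : Γ.V} (q : Σ c : Chain Γ x y, (Fin c.dim → I)) (s : X x) : X y :=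
  open scoped Classical in
  if h : q.1.dim = n + 1 ∧ ¬ (x = Γ.vinit ∧ y = Γ.vfin) then (G ⟨x, y, q.1, h.1, h.2⟩).1 (s, q.2)
  else (X y).pt

/-- The multiplicative extension to `WΓ` of `F` on the `n`-skeleton and of `G` on the indecomposable
`(n+1)`-cubes. On further indecomposable morphisms its values are constant maps. -/
def CFunctor.extendMap (F : CFunctor X (skeleton Γ n))
    (G : ∀ C : IndecCube Γ (n + 1), HalfSmashMap (X C.src) (X C.tgt) (Fin C.chain.dim → I))
    {x y : Γ.V} (a : W Γ x y) : X x → X y :=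
  open scoped Classical in
  a.lift (M := fun x y => X x → X y) (fun _ _ _ f g => g ∘ f) fun x y b =>
    if h : b ∈ (skeleton Γ n).mor x y then F.map ⟨b, h⟩ else cubeValue G b.nf.toSigma

section ExtendMap

variable (F : CFunctor X (skeleton Γ n))
  (G : ∀ C : IndecCube Γ (n + 1), HalfSmashMap (X C.src) (X C.tgt) (Fin C.chain.dim → I))

theorem CFunctor.extendMap_comp {x y z : Γ.V} (a : W Γ x y) (b : W Γ y z) :
    F.extendMap G (a.comp b) = F.extendMap G b ∘ F.extendMap G a :=
  W.lift_comp _ _ (fun _ _ _ _ _ _ _ => rfl) a b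

theorem CFunctor.extendMap_of_mem {x y : Γ.V} {a : W Γ x y} (ha : a ∈ (skeleton Γ n).mor x y) :
    F.extendMap G a = F.map ⟨a, ha⟩ := by
  induction a using W.induction_interior with
  | interior c t ht =>
    exact (W.lift_of_not_isDecomposable _ _ (W.not_isDecomposable_cube ht)).trans (dif_pos ha)
  | comp a b iha ihb =>
    obtain ⟨ha', hb'⟩ := inSkeleton_comp_iff.1 ha
    rw [F.extendMap_comp, iha ha', ihb hb']
    exact (funext (F.map_comp ⟨a, ha'⟩ ⟨b, hb'⟩)).symm

theorem CFunctor.extendMap_of_interior {x y : Γ.V} {c : Chain Γ x y} {t : Fin c.dim → I}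
    (ht : t ∉ cubeBoundary c.dim) (hc : W.cube c t ∉ (skeleton Γ n).mor x y) :
    F.extendMap G (W.cube c t) = cubeValue G ⟨c, t⟩ := by
  refine (W.lift_of_not_isDecomposable _ _ (W.not_isDecomposable_cube ht)).trans ?_
  rw [dif_neg hc, W.nf_cube (notMem_cubeBoundary.1 ht).1, WPt.toSigma_mk]

theorem CFunctor.extendMap_pt {x y : Γ.V} (a : W Γ x y) :
    F.extendMap G a (X x).pt = (X y).pt := by
  induction a using W.induction_interior with
  | @interior x y c t ht =>
    by_cases hc : W.cube c t ∈ (skeleton Γ n).mor x y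
    · rw [F.extendMap_of_mem G hc, F.map_pt]
    · rw [F.extendMap_of_interior G ht hc, cubeValue]
      split_ifs with h
      · exact (G _).2 _
      · rfl
  | comp a b iha ihb => rw [F.extendMap_comp, Function.comp_apply, iha, ihb]

variable {F G}

theorem CFunctor.extendMap_cube (C : IndecCube Γ (n + 1)) (hG : F.IsFilling C (G C)) (s : X C.src)
    (t : Fin C.chain.dim → I) : F.extendMap G (W.cube C.chain t) s = (G C).1 (s, t) := by
  by_cases ht : t ∈ cubeBoundary C.chain.dim
  · rw [F.extendMap_of_mem G (boundary_mem_skeleton C ht), hG s t ht]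
  · have hC : W.cube C.chain t ∉ (skeleton Γ n).mor C.src C.tgt := fun h => by
      have := ((inSkeleton_cube_iff ht).1 h).2
      rw [C.dim_eq] at this
      omega
    rw [F.extendMap_of_interior G ht hC]
    exact dif_pos ⟨C.dim_eq, C.proper⟩

end ExtendMap

theorem CFunctor.continuous_extendMap {T : Type*} [TopologicalSpace T]
    {F : T → CFunctor X (skeleton Γ n)} (hF : CFunctor.IsContinuousFamily F)
    {G : T → ∀ C : IndecCube Γ (n + 1), HalfSmashMap (X C.src) (X C.tgt) (Fin C.chain.dim → I)}
    (hG : ∀ C : IndecCube Γ (n + 1), Continuous fun p : (T × X C.src) × (Fin C.chain.dim → I) =>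
      (G p.1.1 C).1 (p.1.2, p.2))
    (hfill : ∀ r C, (F r).IsFilling C (G r C)) (x y : Γ.V) :
    Continuous fun p : (T × X x) × (skeleton Γ (n + 1)).mor x y =>
      (F p.1.1).extendMap (G p.1.1) (p.2 : W Γ x y) p.1.2 := by
  refine continuous_skeleton_of_cubes (X := fun x => X x)
    (E := fun r _ _ a => (F r).extendMap (G r) a)
    (fun r _ _ _ a b => (F r).extendMap_comp (G r) a b) (fun {x y} c hxy hd => ?_) x y
  rcases hd.eq_or_lt with hd | hd
  · exact (hG ⟨x, y, c, hd, hxy⟩).congr fun p =>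
      (CFunctor.extendMap_cube ⟨x, y, c, hd, hxy⟩ (hfill _ _) _ _).symm
  · have hmem := cube_mem_skeleton hxy (Nat.lt_succ_iff.1 hd)
    simp only [CFunctor.extendMap_of_mem _ _ (hmem _)]
    exact (hF x y).comp (continuous_fst.prodMk
      (Continuous.subtype_mk ((continuous_cube c).comp continuous_snd) fun p => hmem p.2))

theorem CFunctor.exists_family_extension {T : Type*} [TopologicalSpace T]
    {F : T → CFunctor X (skeleton Γ n)} (hF : CFunctor.IsContinuousFamily F)
    {G : T → ∀ C : IndecCube Γ (n + 1), HalfSmashMap (X C.src) (X C.tgt) (Fin C.chain.dim → I)}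
    (hG : ∀ C : IndecCube Γ (n + 1), Continuous fun p : (T × X C.src) × (Fin C.chain.dim → I) =>
      (G p.1.1 C).1 (p.1.2, p.2))
    (hfill : ∀ r C, (F r).IsFilling C (G r C)) :
    ∃ E : T → CFunctor X (skeleton Γ (n + 1)), CFunctor.IsContinuousFamily E ∧
      ∀ r, (E r).Agree (F r) ∧ ∀ C, (E r).onCube C = G r C := by
  have hcont := CFunctor.continuous_extendMap hF hG hfill
  let E (r : T) : CFunctor X (skeleton Γ (n + 1)) :=
    { map := fun a => (F r).extendMap (G r) a.1
      continuous_map := fun x y => (hcont x y).comp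
        ((Continuous.prodMk_right r |>.comp continuous_fst).prodMk continuous_snd)
      map_pt := fun a => (F r).extendMap_pt (G r) a.1
      map_comp := fun a b s => congrFun ((F r).extendMap_comp (G r) a.1 b.1) s }
  refine ⟨E, hcont, fun r => ⟨fun x y a _ ha => (F r).extendMap_of_mem (G r) ha, fun C => ?_⟩⟩
  exact Subtype.ext (ContinuousMap.ext fun p => CFunctor.extendMap_cube C (hfill r C) p.1 p.2)

theorem CFunctor.exists_extension (F : CFunctor X (skeleton Γ n))
    (G : ∀ C : IndecCube Γ (n + 1), HalfSmashMap (X C.src) (X C.tgt) (Fin C.chain.dim → I))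
    (hfill : ∀ C, F.IsFilling C (G C)) :
    ∃ E : CFunctor X (skeleton Γ (n + 1)), E.Agree F ∧ ∀ C, E.onCube C = G C := by
  obtain ⟨E, -, hE⟩ := CFunctor.exists_family_extension (T := Unit) (F := fun _ => F)
    (G := fun _ => G)
    (fun x y => (F.continuous_map x y).comp
      ((continuous_snd.comp continuous_fst).prodMk continuous_snd))
    (fun C => (G C).1.continuous.comp
      ((continuous_snd.comp continuous_fst).prodMk continuous_snd)) fun _ => hfill
  exact ⟨E (), hE ()⟩

end Functors

section CubeDepth

variable {n : ℕ}

/-- The distance of a point of a cube from the boundary, scaled and truncated so that it is `1` on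
the concentric cube of half the size. -/
def cubeDepth (t : Fin n → I) : I :=
  Set.projIcc 0 1 zero_le_one (2 - 4 * ‖fun i => (t i : ℝ) - 1 / 2‖)

/-- Expansion of a cube from its centre by the factor `1 + a`, truncated at the boundary. -/
def cubeExpand (a : I) (t : Fin n → I) (i : Fin n) : I :=
  Set.projIcc 0 1 zero_le_one (1 / 2 + (1 + a) * ((t i : ℝ) - 1 / 2))

theorem continuous_cubeDepth : Continuous (cubeDepth (n := n)) :=
  continuous_projIcc.comp (by fun_prop)

theorem continuous_cubeExpand : Continuous fun p : I × (Fin n → I) => cubeExpand p.1 p.2 :=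
  continuous_pi fun _ => continuous_projIcc.comp (by fun_prop)

theorem cubeExpand_zero (t : Fin n → I) : cubeExpand 0 t = t := by
  funext i
  have h : 1 / 2 + (1 + ((0 : I) : ℝ)) * ((t i : ℝ) - 1 / 2) = t i := by
    rw [Set.Icc.coe_zero]
    ring
  rw [cubeExpand, h, Set.projIcc_val]

theorem cubeDepth_eq_zero {t : Fin n → I} (h : t ∈ cubeBoundary n) : cubeDepth t = 0 := by
  obtain ⟨i, hi⟩ := h
  have hnorm : 1 / 2 ≤ ‖fun i => (t i : ℝ) - 1 / 2‖ := by
    refine le_trans ?_ (norm_le_pi_norm _ i)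
    rcases hi with hi | hi <;> norm_num [hi]
  exact Set.projIcc_of_le_left _ (by linarith)

-- With `N = ‖t - 1 / 2‖ ∈ [1 / 4, 1 / 2]`, the expanded point is at distance at least
-- `(3 - 4 * N) * N ≥ 1 / 2` from the centre, as `(4 * N - 1) * (N - 1 / 2) ≤ 0`.
theorem cubeDepth_eq_one_or_cubeExpand_mem (t : Fin n → I) :
    cubeDepth t = 1 ∨ cubeExpand (cubeDepth t) t ∈ cubeBoundary n := by
  rcases le_or_gt ‖fun i => (t i : ℝ) - 1 / 2‖ (1 / 4) with hN | hN
  · exact .inl (Set.projIcc_of_right_le _ (by linarith))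
  obtain ⟨i, hi⟩ : ∃ i, ‖fun i => (t i : ℝ) - 1 / 2‖ ≤ |(t i : ℝ) - 1 / 2| := by
    by_contra! hlt
    exact lt_irrefl _ ((pi_norm_lt_iff (by linarith)).2 hlt)
  have hti : |(t i : ℝ) - 1 / 2| ≤ 1 / 2 :=
    abs_le.2 ⟨by linarith [(t i).2.1], by linarith [(t i).2.2]⟩
  have hdepth : (cubeDepth t : ℝ) = 2 - 4 * ‖fun i => (t i : ℝ) - 1 / 2‖ := by
    rw [cubeDepth, Set.projIcc_of_mem _ ⟨by linarith, by linarith⟩]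
  refine .inr ⟨i, ?_⟩
  rw [cubeExpand, hdepth]
  rcases le_abs.1 hi with hi | hi
  · exact .inr (Set.projIcc_of_right_le _ (by nlinarith [le_abs_self ((t i : ℝ) - 1 / 2)]))
  · exact .inl (Set.projIcc_of_le_left _ (by nlinarith [neg_le_abs ((t i : ℝ) - 1 / 2)]))

end CubeDepth

section CubeHomotopies

variable {X Y : PointedSpace.{w}} {n : ℕ}

/-- The map that runs through the homotopy `H` on a collar of `X × ∂I^n`, and is `g` on a smaller
cube. -/
def pushOff {F g : C(X × (Fin n → I), Y)} (H : F.Homotopy g) : C(X × (Fin n → I), Y) where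
  toFun p := H (cubeDepth p.2, p.1, cubeExpand (cubeDepth p.2) p.2)
  continuous_toFun := by
    have hd : Continuous fun p : X × (Fin n → I) => cubeDepth p.2 :=
      continuous_cubeDepth.comp continuous_snd
    exact H.continuous.comp (hd.prodMk (continuous_fst.prodMk
      (continuous_cubeExpand.comp (hd.prodMk continuous_snd))))

theorem homotopicRel_pushOff {F : HalfSmashMap X Y (Fin n → I)} {g : C(X × (Fin n → I), Y)}
    (H : F.1.HomotopyRel g {p | p.1 = X.pt}) :
    F.1.HomotopicRel (pushOff H.toHomotopy) {p | p.1 = X.pt ∨ p.2 ∈ cubeBoundary n} := by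
  have hd : Continuous fun p : I × X × (Fin n → I) => p.1 * cubeDepth p.2.2 :=
    continuous_fst.mul (continuous_cubeDepth.comp (continuous_snd.comp continuous_snd))
  refine ⟨⟨⟨⟨fun p => H (p.1 * cubeDepth p.2.2, p.2.1, cubeExpand (p.1 * cubeDepth p.2.2) p.2.2),
    H.continuous.comp (hd.prodMk ((continuous_fst.comp continuous_snd).prodMk
      (continuous_cubeExpand.comp (hd.prodMk (continuous_snd.comp continuous_snd)))))⟩,
    fun p => ?_, fun p => ?_⟩, ?_⟩⟩
  · change H (0 * _, p.1, cubeExpand (0 * _) p.2) = F.1 p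
    rw [zero_mul, cubeExpand_zero, H.apply_zero]
  · change H (1 * _, p.1, cubeExpand (1 * _) p.2) = _
    rw [one_mul]
    rfl
  · rintro r ⟨s, t⟩ (rfl | ht)
    · exact (H.eq_fst _ rfl).trans ((F.2 _).trans (F.2 t).symm)
    · change H (r * cubeDepth t, s, cubeExpand (r * cubeDepth t) t) = F.1 (s, t)
      rw [cubeDepth_eq_zero ht, mul_zero, cubeExpand_zero, H.apply_zero]

theorem homotopicRel_of_isNull_differenceObstruction {F₁ F₂ : HalfSmashMap X Y (Fin n → I)}
    {h : ∀ (s : X), ∀ t ∈ cubeBoundary n, F₁.1 (s, t) = F₂.1 (s, t)}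
    (hnull : (differenceObstruction F₁ F₂ h).IsNull) :
    F₁.1.HomotopicRel F₂.1 {p | p.1 = X.pt ∨ p.2 ∈ cubeBoundary n} := by
  obtain ⟨g, ⟨H⟩⟩ := hnull
  let half (b : Bool) : C(X × (Fin n → I), X × Double (cubeBoundary n)) :=
    .prodMap (.id X) ⟨fun t => Double.mk _ (t, b),
      (Double.isProperMap_mk (isClosed_cubeBoundary n)).continuous.comp (by fun_prop)⟩
  let K₁ : F₁.1.HomotopyRel (g.1.comp .fst) {p | p.1 = X.pt} :=
    ⟨H.toHomotopy.compContinuousMap (half true), fun r p hp => H.prop' r (half true p) hp⟩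
  let K₂ : F₂.1.HomotopyRel (g.1.comp .fst) {p | p.1 = X.pt} :=
    ⟨H.toHomotopy.compContinuousMap (half false), fun r p hp => H.prop' r (half false p) hp⟩
  have hglue (s : X) {t : Fin n → I} (ht : t ∈ cubeBoundary n) :
      half true (s, t) = half false (s, t) := Prod.ext rfl (Quot.sound (.glue t ht))
  have heq : pushOff K₁.toHomotopy = pushOff K₂.toHomotopy := by
    ext ⟨s, t⟩
    rcases cubeDepth_eq_one_or_cubeExpand_mem t with ht | ht
    · change K₁ (cubeDepth t, _) = K₂ (cubeDepth t, _)
      rw [ht, K₁.apply_one, K₂.apply_one]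
    · exact congrArg (fun p => H (cubeDepth t, p)) (hglue s ht)
  exact (homotopicRel_pushOff K₁).trans (heq ▸ (homotopicRel_pushOff K₂).symm)

theorem exists_extension_of_boundary_homotopy (F : HalfSmashMap X Y (Fin n → I))
    (h : (X × (Fin n → I)) × I → Y) (hc : ContinuousOn h {p | p.1.2 ∈ cubeBoundary n})
    (h0 : ∀ s, ∀ t ∈ cubeBoundary n, h ((s, t), 0) = F.1 (s, t))
    (hpt : ∀ t ∈ cubeBoundary n, ∀ r, h ((X.pt, t), r) = Y.pt) :
    ∃ F' : HalfSmashMap X Y (Fin n → I),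
      ∀ s, ∀ t ∈ cubeBoundary n, F'.1 (s, t) = h ((s, t), 1) := by
  classical
  let q (p : X × (Fin n → I)) : X × (Fin n → I) := (p.1, cubeExpand (cubeDepth p.2) p.2)
  let τ (p : X × (Fin n → I)) : I := unitInterval.symm (cubeDepth p.2)
  have hd : Continuous fun p : X × (Fin n → I) => cubeDepth p.2 :=
    continuous_cubeDepth.comp continuous_snd
  have hq : Continuous q :=
    continuous_fst.prodMk (continuous_cubeExpand.comp (hd.prodMk continuous_snd))
  let e (p : X × (Fin n → I)) : Y :=
    if (q p).2 ∈ cubeBoundary n then h (q p, τ p) else F.1 (q p)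
  have he_depth_one {p : X × (Fin n → I)} (hp : cubeDepth p.2 = 1) : e p = F.1 (q p) := by
    by_cases hb : (q p).2 ∈ cubeBoundary n
    · have hτ : τ p = 0 := by simp only [τ, hp, unitInterval.symm_one]
      simp only [e, if_pos hb, hτ]
      exact h0 _ _ hb
    · exact if_neg hb
  have he : Continuous e := by
    have hcover : {p | (q p).2 ∈ cubeBoundary n} ∪ {p | cubeDepth p.2 = 1} = Set.univ :=
      Set.eq_univ_of_forall fun p => (cubeDepth_eq_one_or_cubeExpand_mem p.2).symm
    rw [← continuousOn_univ, ← hcover]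
    refine ContinuousOn.union_of_isClosed ?_ ?_
      ((isClosed_cubeBoundary n).preimage (continuous_snd.comp hq))
      (isClosed_eq hd continuous_const)
    · refine (hc.comp (f := fun p => (q p, τ p))
        (hq.prodMk (unitInterval.continuous_symm.comp hd)).continuousOn fun p hp => hp).congr
        fun p hp => if_pos hp
    · exact (F.1.continuous.comp hq).continuousOn.congr fun p hp => he_depth_one hp
  refine ⟨⟨⟨e, he⟩, fun t => ?_⟩, fun s t ht => ?_⟩
  · change ite _ _ _ = _
    split_ifs with hb
    · exact hpt _ hb _
    · exact F.2 _
  · have hqt : q (s, t) = (s, t) := by simp only [q, cubeDepth_eq_zero ht, cubeExpand_zero]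
    have hτt : τ (s, t) = 1 := by simp only [τ, cubeDepth_eq_zero ht, unitInterval.symm_zero]
    change ite _ _ _ = _
    rw [hqt, hτt, if_pos ht]

theorem contractibleSpace_cube (n : ℕ) : ContractibleSpace (Fin n → I) :=
  (contractible_iff_id_nullhomotopic _).2 ⟨0, ⟨{
    toFun := fun p i => unitInterval.symm p.1 * p.2 i
    continuous_toFun := by fun_prop
    map_zero_left := fun t => by simp
    map_one_left := fun t => by funext i; simp }⟩⟩

theorem HalfSmashMap.isNull_of_factors {C K : Type} [TopologicalSpace C] [TopologicalSpace K]
    [ContractibleSpace C] {f : HalfSmashMap X Y K} (F : HalfSmashMap X Y C) (φ : C(K, C))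
    (hf : ∀ s c, f.1 (s, c) = F.1 (s, φ c)) : f.IsNull := by
  obtain ⟨c₀, ⟨H⟩⟩ := id_nullhomotopic C
  refine ⟨⟨F.1.comp (.prodMk (.id X) (.const X c₀)), F.2 c₀⟩, ⟨⟨⟨⟨fun p =>
    F.1 (p.2.1, H (p.1, φ p.2.2)), by fun_prop⟩, fun p => ?_, fun p => ?_⟩, ?_⟩⟩⟩
  · exact (congrArg (fun c => F.1 (p.1, c)) (H.apply_zero _)).trans (hf p.1 p.2).symm
  · exact congrArg (fun c => F.1 (p.1, c)) (H.apply_one _)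
  · rintro r ⟨s, c⟩ rfl
    exact (F.2 _).trans (f.2 c).symm

theorem isNull_differenceObstruction_self (F : HalfSmashMap X Y (Fin n → I)) :
    (differenceObstruction F F fun _ _ _ => rfl).IsNull := by
  let fold : C(Double (cubeBoundary n), Fin n → I) :=
    ⟨Double.lift Prod.fst fun _ _ => rfl, continuous_quot_lift _ continuous_fst⟩
  have := contractibleSpace_cube n
  refine HalfSmashMap.isNull_of_factors F fold ?_
  rintro s ⟨t, _ | _⟩ <;> rfl

end CubeHomotopies

/-- The reflexive closure of the relation "there is an arrow". -/
def LatticeCat.Reaches (x y : Γ.V) : Prop := x = y ∨ Nonempty (Γ.Hom x y)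

theorem LatticeCat.Reaches.of_hom_left {x y z : Γ.V} (f : Γ.Hom x y) (h : Reaches y z) :
    Reaches x z :=
  .inr (h.elim (fun e => e ▸ ⟨f⟩) fun ⟨g⟩ => ⟨Γ.comp f g⟩)

theorem LatticeCat.Reaches.eq_vinit {x : Γ.V} (h : Reaches x Γ.vinit) : x = Γ.vinit :=
  h.resolve_right (not_nonempty_iff.2 (isEmpty_hom_vinit x))

theorem LatticeCat.Reaches.eq_vfin {x : Γ.V} (h : Reaches Γ.vfin x) : x = Γ.vfin :=
  (h.resolve_right (not_nonempty_iff.2 (isEmpty_hom_vfin x))).symm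

theorem Chain.nonempty_hom {x y : Γ.V} (c : Chain Γ x y) : Nonempty (Γ.Hom x y) :=
  (W.cube c 0).nonempty_hom

open LatticeCat (Reaches)

theorem Chain.reaches_of_mem {x y : Γ.V} {c : Chain Γ x y} {f : Σ a b : Γ.V, Γ.Hom a b}
    (hf : f ∈ c.arrows) : Reaches x f.1 ∧ Reaches f.2.1 y := by
  induction c with
  | single g =>
    obtain rfl := List.mem_singleton.1 hf
    exact ⟨.inl rfl, .inl rfl⟩
  | cons g c ih =>
    rcases List.mem_cons.1 hf with rfl | hf
    · exact ⟨.inl rfl, .inr c.nonempty_hom⟩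
    · exact ⟨(ih hf).1.of_hom_left g, (ih hf).2⟩

theorem Generated.reaches {x y a b : Γ.V} {Ψ : Chain Γ x y} {f : Γ.Hom a b}
    (h : Generated Ψ f) : Reaches x a ∧ Reaches b y := by
  induction h with
  | of f hf => exact Chain.reaches_of_mem hf
  | comp _ _ _ _ ihf ihg => exact ⟨ihf.1, ihg.2⟩

theorem IsSubchain.reaches {x y a b : Γ.V} {χ : Chain Γ a b} {Ψ : Chain Γ x y}
    (h : IsSubchain χ Ψ) : Reaches x a ∧ Reaches b y := by
  induction χ with
  | single f => exact (h _ (List.mem_singleton_self _)).reaches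
  | cons f c ih =>
    obtain ⟨hf, hc⟩ := List.forall_mem_cons.1 h
    exact ⟨hf.reaches.1, (ih hc).2⟩

theorem IsSubchain.proper {x y a b : Γ.V} {χ : Chain Γ a b} {Ψ : Chain Γ x y}
    (h : IsSubchain χ Ψ) (hΨ : ¬ (x = Γ.vinit ∧ y = Γ.vfin)) :
    ¬ (a = Γ.vinit ∧ b = Γ.vfin) := by
  rintro ⟨rfl, rfl⟩
  exact hΨ ⟨h.reaches.1.eq_vinit, h.reaches.2.eq_vfin⟩

/-- The targets of the arrows of a chain. -/
def Chain.targets {x y : Γ.V} (c : Chain Γ x y) : List Γ.V := c.arrows.map fun f => f.2.1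

theorem Chain.length_targets {x y : Γ.V} (c : Chain Γ x y) : c.targets.length = c.dim + 1 := by
  rw [targets, List.length_map]
  induction c with
  | single f => rfl
  | cons f c ih => rw [arrows, List.length_cons, ih, dim]

theorem Chain.nodup_targets {x y : Γ.V} (c : Chain Γ x y) : c.targets.Nodup := by
  induction c with
  | single f => exact List.nodup_singleton _
  | @cons x y z f c ih =>
    refine List.nodup_cons.2 ⟨fun h => ?_, ih⟩
    obtain ⟨⟨a, b, g⟩, hg, rfl : b = y⟩ := List.mem_map.1 h
    rcases (Chain.reaches_of_mem hg).1 with rfl | ⟨⟨k⟩⟩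
    · exact (Γ.directed _).false g
    · exact (Γ.directed _).false (Γ.comp k g)

theorem Generated.target_mem {x y a b : Γ.V} {Ψ : Chain Γ x y} {f : Γ.Hom a b}
    (h : Generated Ψ f) : b ∈ Ψ.targets := by
  induction h with
  | of f hf => exact List.mem_map.2 ⟨_, hf, rfl⟩
  | comp _ _ _ _ _ ih => exact ih

theorem IsSubchain.dim_le {x y a b : Γ.V} {χ : Chain Γ a b} {Ψ : Chain Γ x y}
    (h : IsSubchain χ Ψ) : χ.dim ≤ Ψ.dim := by
  have hsub : χ.targets ⊆ Ψ.targets := by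
    intro z hz
    obtain ⟨f, hf, rfl⟩ := List.mem_map.1 hz
    exact (h f hf).target_mem
  have hlen := (χ.nodup_targets.subperm hsub).length_le
  rwa [χ.length_targets, Ψ.length_targets, Nat.add_le_add_iff_right] at hlen

theorem subW_le_skeleton {n : ℕ} (C : IndecCube Γ n) {a b : Γ.V} {r : W Γ a b}
    (h : r ∈ (subW C.chain).mor a b) : r ∈ (skeleton Γ n).mor a b := by
  induction r using W.induction_interior with
  | interior c t ht =>
    have hc := (cube_mem_subW_iff ht).1 h
    exact cube_mem_skeleton (hc.proper C.proper) (hc.dim_le.trans_eq C.dim_eq) t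
  | comp r s ihr ihs =>
    obtain ⟨hr, hs⟩ := comp_mem_subW_iff.1 h
    exact .comp _ _ (ihr hr) (ihs hs)

/-- The restriction of a functor to a smaller subcategory. -/
def CFunctor.restrict {X : Γ.V → PointedSpace.{w}} {U U' : Subcat Γ} (F : CFunctor X U)
    (h : ∀ {x y : Γ.V} {a : W Γ x y}, a ∈ U'.mor x y → a ∈ U.mor x y) : CFunctor X U' where
  map a := F.map ⟨a.1, h a.2⟩
  continuous_map x y := (F.continuous_map x y).comp (continuous_fst.prodMk
    ((continuous_subtype_val.comp continuous_snd).subtype_mk fun p => h p.2.2))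
  map_pt _ := F.map_pt _
  map_comp a b s := F.map_comp ⟨a.1, h a.2⟩ ⟨b.1, h b.2⟩ s

theorem exists_vanishing_of_extends {A : InitialData.{u, v, w} Γ} {k : ℕ}
    {R : Realization A (k - 1)} {R' : Realization A (k + 1)} (h : R'.Extends R) :
    ∃ F : CubeExtensions k R, F.Vanishes :=
  ⟨{ functor := fun C => R'.toFunctor.restrict (subW_le_skeleton C)
     extend := fun C x y a ha ha' => h.2 x y a (subW_le_skeleton C ha) ha' },
    fun _ => isNull_differenceObstruction_self _⟩

section Extension

variable {X : Γ.V → PointedSpace.{w}} {n : ℕ}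

theorem CFunctor.exists_family_of_homotopicRel (F : CFunctor X (skeleton Γ n))
    {g₀ g₁ : ∀ C : IndecCube Γ (n + 1), HalfSmashMap (X C.src) (X C.tgt) (Fin C.chain.dim → I)}
    (hfill : ∀ C, F.IsFilling C (g₀ C))
    (h : ∀ C : IndecCube Γ (n + 1), (g₀ C).1.HomotopicRel (g₁ C).1
      {p | p.1 = (X C.src).pt ∨ p.2 ∈ cubeBoundary C.chain.dim}) :
    ∃ E : I → CFunctor X (skeleton Γ (n + 1)), CFunctor.IsContinuousFamily E ∧
      (∀ r, (E r).Agree F) ∧ ∀ C, (E 0).onCube C = g₀ C ∧ (E 1).onCube C = g₁ C := by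
  let H (C : IndecCube Γ (n + 1)) := (h C).some
  let G (r : I) (C : IndecCube Γ (n + 1)) :
      HalfSmashMap (X C.src) (X C.tgt) (Fin C.chain.dim → I) :=
    ⟨(H C).toHomotopy.curry r, fun t => ((H C).eq_fst r (.inl rfl)).trans ((g₀ C).2 t)⟩
  obtain ⟨E, hE, hEG⟩ := CFunctor.exists_family_extension (F := fun _ : I => F) (G := G)
    (fun x y => (F.continuous_map x y).comp
      ((continuous_snd.comp continuous_fst).prodMk continuous_snd))
    (fun C => (H C).continuous.comp ((continuous_fst.comp continuous_fst).prodMk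
      ((continuous_snd.comp continuous_fst).prodMk continuous_snd)))
    fun r C s t ht => ((H C).eq_fst r (.inr ht)).trans (hfill C s t ht)
  refine ⟨E, hE, fun r => (hEG r).1, fun C => ⟨?_, ?_⟩⟩
  · exact ((hEG 0).2 C).trans (Subtype.ext (ContinuousMap.ext (H C).apply_zero))
  · exact ((hEG 1).2 C).trans (Subtype.ext (ContinuousMap.ext (H C).apply_one))

theorem CFunctor.IsContinuousFamily.exists_isFilling {E : I → CFunctor X (skeleton Γ n)}
    (hE : CFunctor.IsContinuousFamily E) {C : IndecCube Γ (n + 1)}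
    {g : HalfSmashMap (X C.src) (X C.tgt) (Fin C.chain.dim → I)} (hg : (E 0).IsFilling C g) :
    ∃ g', (E 1).IsFilling C g' := by
  classical
  let h (p : (X C.src × (Fin C.chain.dim → I)) × I) : X C.tgt :=
    if ht : p.1.2 ∈ cubeBoundary C.chain.dim then
      (E p.2).map ⟨W.cube C.chain p.1.2, boundary_mem_skeleton C ht⟩ p.1.1
    else (X C.tgt).pt
  have hh (s : X C.src) {t} (ht : t ∈ cubeBoundary C.chain.dim) (r : I) :
      h ((s, t), r) = (E r).map ⟨W.cube C.chain t, boundary_mem_skeleton C ht⟩ s := dif_pos ht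
  have hc : ContinuousOn h {p | p.1.2 ∈ cubeBoundary C.chain.dim} := by
    rw [continuousOn_iff_continuous_domRestrict]
    let B := {p : (X C.src × (Fin C.chain.dim → I)) × I | p.1.2 ∈ cubeBoundary C.chain.dim}
    let cube (p : B) : (skeleton Γ n).mor C.src C.tgt :=
      ⟨W.cube C.chain p.1.1.2, boundary_mem_skeleton C p.2⟩
    have hcube : Continuous cube :=
      Continuous.subtype_mk ((continuous_cube C.chain).comp (by fun_prop)) _
    exact ((hE C.src C.tgt).comp (f := fun p : B => ((p.1.2, p.1.1.1), cube p))
      (.prodMk (by fun_prop) hcube)).congr fun p => (hh p.1.1.1 p.2 p.1.2).symm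
  obtain ⟨g', hg'⟩ := exists_extension_of_boundary_homotopy g h hc
    (fun s t ht => (hh s ht 0).trans (hg s t ht).symm)
    fun t ht r => (hh _ ht r).trans ((E r).map_pt _)
  exact ⟨g', fun s t ht => (hg' s t ht).trans (hh s ht 1)⟩

theorem isSubchain_refl {x y : Γ.V} (c : Chain Γ x y) : IsSubchain c c :=
  fun f hf => .of f.2.2 hf

theorem CFunctor.Agree.symm {U U' : Subcat Γ} {F : CFunctor X U} {G : CFunctor X U'}
    (h : F.Agree G) : G.Agree F := fun x y a ha ha' => (h x y a ha' ha).symm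

theorem CFunctor.Agree.isFilling_onCube {F : CFunctor X (skeleton Γ (n + 1))}
    {R : CFunctor X (skeleton Γ n)} (h : F.Agree R) (C : IndecCube Γ (n + 1)) :
    R.IsFilling C (F.onCube C) := fun s t ht =>
  congrFun (h _ _ _ (cube_mem_skeleton C.proper C.dim_eq.le t) (boundary_mem_skeleton C ht)) s

theorem CFunctor.Agree.isFilling_restrictCube {x y : Γ.V} {Ψ : Chain Γ x y}
    {F : CFunctor X (subW Ψ)} {R : CFunctor X (skeleton Γ n)} (h : F.Agree R)
    {C : IndecCube Γ (n + 1)} (hC : IsSubchain C.chain Ψ) :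
    R.IsFilling C (F.restrictCube hC) := fun s t ht =>
  congrFun (h _ _ _ (cube_mem_subW hC t) (boundary_mem_skeleton C ht)) s

theorem CFunctor.exists_isFilling_of_homotopicRel {R : CFunctor X (skeleton Γ n)}
    {F : CFunctor X (skeleton Γ (n + 1))} (hF : F.Agree R) (Ψ : IndecCube Γ (n + 2))
    {F₀ : CFunctor X (subW Ψ.chain)} (hF₀ : F₀.Agree R)
    (h : ∀ (C : IndecCube Γ (n + 1)) (hC : IsSubchain C.chain Ψ.chain),
      (F₀.restrictCube hC).1.HomotopicRel (F.onCube C).1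
        {p | p.1 = (X C.src).pt ∨ p.2 ∈ cubeBoundary C.chain.dim}) :
    ∃ g, F.IsFilling Ψ g := by
  classical
  let g₀ (C : IndecCube Γ (n + 1)) : HalfSmashMap (X C.src) (X C.tgt) (Fin C.chain.dim → I) :=
    if hC : IsSubchain C.chain Ψ.chain then F₀.restrictCube hC else F.onCube C
  have hg₀ {C} (hC : IsSubchain C.chain Ψ.chain) : g₀ C = F₀.restrictCube hC := dif_pos hC
  have hg₀' {C} (hC : ¬ IsSubchain C.chain Ψ.chain) : g₀ C = F.onCube C := dif_neg hC
  have hfill (C : IndecCube Γ (n + 1)) : R.IsFilling C (g₀ C) := by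
    by_cases hC : IsSubchain C.chain Ψ.chain
    · exact hg₀ hC ▸ hF₀.isFilling_restrictCube hC
    · exact hg₀' hC ▸ hF.isFilling_onCube C
  obtain ⟨E, hE, hER, hEg⟩ := R.exists_family_of_homotopicRel hfill (g₁ := F.onCube) fun C => by
    by_cases hC : IsSubchain C.chain Ψ.chain
    · rw [hg₀ hC]
      exact h C hC
    · rw [hg₀' hC]
      exact .refl _
  have hE₀ : (E 0).Agree F₀ :=
    CFunctor.agree_of_agree_on_cubes comp_mem_subW_iff.1 (hER 0) hF₀ fun C s t ht hm => by
      rw [(hEg C).1, hg₀ ((cube_mem_subW_iff ht).1 hm)]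
      rfl
  have hE₁ : (E 1).Agree F :=
    CFunctor.agree_of_agree_on_cubes inSkeleton_comp_iff.1 (hER 1) hF fun C s t _ _ => by
      rw [(hEg C).2]
      rfl
  obtain ⟨g, hg⟩ := hE.exists_isFilling (C := Ψ)
    (hE₀.symm.isFilling_restrictCube (isSubchain_refl Ψ.chain))
  exact ⟨g, fun s t ht => (hg s t ht).trans
    (congrFun (hE₁ _ _ _ (boundary_mem_skeleton Ψ ht) (boundary_mem_skeleton Ψ ht)) s)⟩

end Extension

section Realizations

variable {A : InitialData.{u, v, w} Γ} {n : ℕ}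

theorem Realization.exists_extends_of_agree {m : ℕ} (R : Realization A m) (hmn : m ≤ n)
    (F : CFunctor A.obj (skeleton Γ n)) (hF : F.Agree R.toFunctor) :
    ∃ R' : Realization A n, R'.Extends R := by
  refine ⟨⟨F, fun {x y} h f => ?_⟩, hmn, hF⟩
  have hmap := hF x y _ (arrow_mem_skeleton n h f) (arrow_mem_skeleton m h f)
  have hpmap : F.pmap ⟨W.arrow f, arrow_mem_skeleton n h f⟩ =
      R.toFunctor.pmap ⟨W.arrow f, arrow_mem_skeleton m h f⟩ :=
    Subtype.ext (ContinuousMap.ext (congrFun hmap))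
  rw [hpmap, R.class_eq h f]

theorem CubeExtensions.Vanishes.exists_common_filling {R : Realization A n}
    {R' : Realization A (n + 1)} (hR' : R'.Extends R) {F : CubeExtensions (k := n + 1) R}
    (hF : F.Vanishes) (χ : IndecCube Γ (n + 1)) :
    ∃ g, R.toFunctor.IsFilling χ g ∧
      ∀ (Ψ : IndecCube Γ (n + 2)) (h : IsSubchain χ.chain Ψ.chain),
        ((F.functor Ψ).restrictCube h).1.HomotopicRel g.1
          {p | p.1 = (A.obj χ.src).pt ∨ p.2 ∈ cubeBoundary χ.chain.dim} := by
  by_cases hχ : ∃ Ψ : IndecCube Γ (n + 2), IsSubchain χ.chain Ψ.chain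
  · obtain ⟨Ψ₀, h₀⟩ := hχ
    refine ⟨_, (F.extend Ψ₀).isFilling_restrictCube h₀, fun Ψ h => ?_⟩
    by_cases e : Ψ = Ψ₀
    · subst e
      exact .refl _
    · exact homotopicRel_of_isNull_differenceObstruction (hF ⟨Ψ, Ψ₀, e, χ, h, h₀⟩)
  · exact ⟨_, hR'.2.isFilling_onCube χ, fun Ψ h => (hχ ⟨Ψ, h⟩).elim⟩

theorem exists_extends_of_vanishing {R : Realization A n} {R' : Realization A (n + 1)}
    (hR' : R'.Extends R) {F : CubeExtensions (k := n + 1) R} (hF : F.Vanishes) :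
    ∃ R'' : Realization A (n + 2), R''.Extends R := by
  choose g hfill hhom using hF.exists_common_filling hR'
  obtain ⟨F₁, hF₁, hF₁g⟩ := R.toFunctor.exists_extension g hfill
  have hΨ (Ψ : IndecCube Γ (n + 2)) : ∃ g', F₁.IsFilling Ψ g' :=
    CFunctor.exists_isFilling_of_homotopicRel hF₁ Ψ (F.extend Ψ) fun C hC => by
      rw [hF₁g]
      exact hhom C Ψ hC
  choose g' hg' using hΨ
  obtain ⟨F₂, hF₂, -⟩ := F₁.exists_extension g' hg'
  refine R.exists_extends_of_agree (Nat.le_add_right n 2) F₂ fun x y a h h' => ?_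
  have h₁ : a ∈ (skeleton Γ (n + 1)).mor x y := InSkeleton.mono n.le_succ h'
  exact (hF₂ x y a h h₁).trans (hF₁ x y a h₁ h')

end Realizations

end HHO

end

theorem theorem3p28 {Γ : HHO.LatticeCat.{u, v}} (A : HHO.InitialData.{u, v, w} Γ)
    (k : ℕ) (hk : 1 ≤ k) (R : HHO.Realization A (k - 1))
    (hR : ∃ R' : HHO.Realization A k, R'.Extends R) :
    (∃ R'' : HHO.Realization A (k + 1), R''.Extends R) ↔
      ∃ F : HHO.CubeExtensions k R, F.Vanishes := by
  constructor
  · rintro ⟨R'', h⟩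
    exact HHO.exists_vanishing_of_extends h
  · rintro ⟨F, hF⟩
    obtain ⟨R', hR'⟩ := hR
    cases k with
    | zero => omega
    | succ n => exact HHO.exists_extends_of_vanishing hR' hF
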